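/- Let $\ell\in(0,1]$ and let $\Phi:[0,\infty)\to[0,\infty)$ be a concave function with $\Phi(0)=0$ and $\lim_{r\to\infty}\Phi(r)=\infty$ such that, for some constant $c_\Phi\ge 1$, $\Phi(tr)\le c_\Phi\max\{t^\ell,t\}\,\Phi(r)$ for all $t,r\ge 0$ (that is, $\Phi\in\mathcal G_\ell$ is concave; $\Phi$ is then an increasing bijection of $[0,\infty)$). Assume that $$q_{\Phi^{-1}}=\sup_{t>0}\frac{t(\Phi^{-1})'(t)}{\Phi^{-1}(t)}<\infty ,$$ where $(\Phi^{-1})'$ is the right derivative of the convex function $\Phi^{-1}$. Let $(\Omega,\mathcal F,P)$ be a probability space with a filtration $(\mathcal F_n)_{n\ge0}$, put $\mathcal F_{-1}=\mathcal F_0$, and let $\mathbb E_n$ be the conditional expectation with respect to $\mathcal F_n$. For measurable $g:\Omega\to[0,\infty]$ let $$\|g\|_{wL_\Phi}=\inf\Big\{c>0:\ \sup_{t>0}\Phi(t/c)\,P(g>t)\le 1\Big\}\in[0,\infty].$$ For a real martingale $f=(f_n)_{n\ge0}$ put $f_{-1}=0$, $df_i=f_i-f_{i-1}$, $M(f)=\sup_i|f_i|$,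 $S_n(f)=(\sum_{i\le n}|df_i|^2)^{1/2}$, $S(f)=(\sum_{i\ge 0}|df_i|^2)^{1/2}$, $s(f)=(\sum_{i\ge0}\mathbb E_{i-1}|df_i|^2)^{1/2}$ (the conditional expectations of the non-negative functions $|df_i|^2$ take values in $[0,\infty]$), and $$\|f\|_{wH_\Phi}=\|M(f)\|_{wL_\Phi},\qquad \|f\|_{wH^S_\Phi}=\|S(f)\|_{wL_\Phi},\qquad \|f\|_{wH^s_\Phi}=\|s(f)\|_{wL_\Phi}.$$ Let $\Lambda$ be the set of all non-decreasing, non-negative, adapted sequences $\lambda=(\lambda_n)_{n\ge0}$ of real functions, with $\lambda_\infty=\lim_n\lambda_n$ and the convention $\lambda_{-1}=\lambda_0$. Let $\|f\|_{w\mathcal Q_\Phi}$ (resp. $\|f\|_{w\mathcal D_\Phi}$) be the infimum of $\|\lambda_\infty\|_{wL_\Phi}$ over all $\lambda\in\Lambda$ such that $S_n(f)\le\lambda_{n-1}$ (resp. $|f_n|\le\lambda_{n-1}$) almost surely for all $n\ge0$ (with $\inf\emptyset=\infty$). The spaces $wH_\Phi,\ wH^S_\Phi,\ wH^s_\Phi$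 consist of the martingales with finite corresponding quasi-norm; $w\mathcal Q_\Phi$ (resp. $w\mathcal D_\Phi$) consists of the martingales for which there is such a $\lambda$ with $\|\lambda_\infty\|_{wL_\Phi}<\infty$. **Theorem.** (a) There is a constant $C>0$ depending only on $\Phi$ such that, for every probability space, every filtration and every martingale $f$, $$\|f\|_{wH_\Phi}\le C\|f\|_{wH^s_\Phi},\qquad \|f\|_{wH^S_\Phi}\le C\|f\|_{wH^s_\Phi};$$ $$\|f\|_{wH_\Phi}\le C\|f\|_{w\mathcal Q_\Phi},\qquad \|f\|_{wH^S_\Phi}\le C\|f\|_{w\mathcal Q_\Phi},\qquad \|f\|_{wH^s_\Phi}\le C\|f\|_{w\mathcal Q_\Phi};$$ $$\|f\|_{wH_\Phi}\le C\|f\|_{w\mathcal D_\Phi},\qquad \|f\|_{wH^S_\Phi}\le C\|f\|_{w\mathcal D_\Phi},\qquad \|f\|_{wH^s_\Phi}\le C\|f\|_{w\mathcal D_\Phi};$$ $$C^{-1}\|f\|_{w\mathcal D_\Phi}\le\|f\|_{w\mathcal Q_\Phi}\le C\|f\|_{w\mathcal D_\Phi}.$$ (b) Suppose that $(\mathcal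 F_n)$ is regular: there is a constant $R$ such that for all $n\ge0$ and $A\in\mathcal F_n$ there is $B\in\mathcal F_{n-1}$ with $A\subset B$ and $P(B)\le R\,P(A)$. Then $$wH^S_\Phi=w\mathcal Q_\Phi=w\mathcal D_\Phi=wH_\Phi=wH^s_\Phi ,$$ and on all martingales the five quasi-norms are equivalent, with a constant depending only on $\Phi$ and $R$. -/

import Mathlib

open MeasureTheory Set Filter Topology
open scoped ENNReal NNReal

universe u

noncomputable section

namespace WeakOrlicz

/-! ### Orlicz-type functions -/

/-- The class of functions `Φ : [0,∞) → [0,∞)` with `Φ 0 = 0`, `Φ(r) → ∞` as `r → ∞`, which are of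
lower type `ℓ` and upper type `1`:
`Φ (t r) ≤ c max (t ^ ℓ) t Φ r` for all `t, r ≥ 0`, for some constant `c ≥ 1`.
Only the values of `Φ` on `[0,∞)` matter. -/
structure MemG (ℓ : ℝ) (Φ : ℝ → ℝ) : Prop where
  nonneg : ∀ r, 0 ≤ r → 0 ≤ Φ r
  map_zero : Φ 0 = 0
  tendsto_atTop : Tendsto Φ atTop atTop
  type_le : ∃ c : ℝ, 1 ≤ c ∧ ∀ t r : ℝ, 0 ≤ t → 0 ≤ r → Φ (t * r) ≤ c * max (t ^ ℓ) t * Φ r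

/-- The inverse function on `[0,∞)` of a bijection `Φ : [0,∞) → [0,∞)`. -/
def inverse (Φ : ℝ → ℝ) : ℝ → ℝ := Function.invFunOn Φ (Ici 0)

/-- The upper index `q_Ψ = sup_{t > 0} t Ψ'(t) / Ψ(t)`, as an element of `[0,∞]`. Here `Ψ'` is the
right derivative, which exists everywhere on `(0,∞)` when `Ψ` is convex or concave and agrees with
the derivative wherever `Ψ` is differentiable. -/
def upperIndex (Ψ : ℝ → ℝ) : ℝ≥0∞ :=
  ⨆ t : ℝ, ⨆ _ : 0 < t, ENNReal.ofReal (t * derivWithin Ψ (Ioi t) t / Ψ t)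

section

variable {Ω : Type u} {m0 : MeasurableSpace Ω}

/-- The weak Orlicz quasi-norm
`‖g‖ = inf {c > 0 : sup_{t > 0} Φ(t / c) P(g > t) ≤ 1}` of a function `g : Ω → [0,∞]`
(equal to `∞` if there is no such `c`). -/
def wnorm (Φ : ℝ → ℝ) (P : Measure Ω) (g : Ω → ℝ≥0∞) : ℝ≥0∞ :=
  sInf {x : ℝ≥0∞ | ∃ c : ℝ, 0 < c ∧ x = ENNReal.ofReal c ∧
    ∀ t : ℝ, 0 < t → ENNReal.ofReal (Φ (t / c)) * P {ω | ENNReal.ofReal t < g ω} ≤ 1}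

/-! ### Maximal function and square functions -/

/-- Martingale differences `df_n = f_n - f_{n-1}`, with `f_{-1} = 0`. -/
def mdiff (f : ℕ → Ω → ℝ) : ℕ → Ω → ℝ
  | 0 => f 0
  | n + 1 => f (n + 1) - f n

/-- The maximal function `M(f) = sup_i |f_i|`. -/
def maxFn (f : ℕ → Ω → ℝ) (ω : Ω) : ℝ≥0∞ := ⨆ i, ‖f i ω‖ₑ

/-- `S_n(f) = (∑_{i ≤ n} |df_i|²)^{1/2}`. -/
def partialSq (f : ℕ → Ω → ℝ) (n : ℕ) (ω : Ω) : ℝ≥0∞ :=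
  (∑ i ∈ Finset.range (n + 1), ‖mdiff f i ω‖ₑ ^ 2) ^ (1 / 2 : ℝ)

/-- The quadratic variation `S(f) = (∑_i |df_i|²)^{1/2}`. -/
def sqFn (f : ℕ → Ω → ℝ) (ω : Ω) : ℝ≥0∞ := (∑' i, ‖mdiff f i ω‖ₑ ^ 2) ^ (1 / 2 : ℝ)

/-- The conditional quadratic variation `s(f) = (∑_i E_{i-1} |df_i|²)^{1/2}`, with `ℱ_{-1} = ℱ_0`.
The conditional expectation is that of a `[0,∞]`-valued function, so that `s(f)` makes sense (with
values in `[0,∞]`) for every martingale, square integrable or not. -/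
def condSqFn (ℱ : Filtration ℕ m0) (P : Measure Ω) (f : ℕ → Ω → ℝ) (ω : Ω) : ℝ≥0∞ :=
  (∑' i, condLExp (ℱ (i - 1)) P (fun ω' => ‖mdiff f i ω'‖ₑ ^ 2) ω) ^ (1 / 2 : ℝ)

/-! ### Predictable controls -/

/-- Non-decreasing, non-negative, adapted sequences `(λ_n)_{n ≥ 0}`. -/
structure IsControl (ℱ : Filtration ℕ m0) (lam : ℕ → Ω → ℝ) : Prop where
  nonneg : ∀ n ω, 0 ≤ lam n ω
  mono : ∀ ω, Monotone fun n => lam n ω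
  adapted : ∀ n, Measurable[ℱ n] (lam n)

/-- `λ_∞ = lim_n λ_n = sup_n λ_n`. -/
def controlLim (lam : ℕ → Ω → ℝ) (ω : Ω) : ℝ≥0∞ := ⨆ n, ENNReal.ofReal (lam n ω)

/-- `(λ_n)` is a control with `S_n(f) ≤ λ_{n-1}` almost surely for all `n`, where
`λ_{-1} = λ_0`. -/
def ControlsSq (ℱ : Filtration ℕ m0) (P : Measure Ω) (f lam : ℕ → Ω → ℝ) : Prop :=
  IsControl ℱ lam ∧ ∀ n, ∀ᵐ ω ∂P, partialSq f n ω ≤ ENNReal.ofReal (lam (n - 1) ω)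

/-- `(λ_n)` is a control with `|f_n| ≤ λ_{n-1}` almost surely for all `n`, where
`λ_{-1} = λ_0`. -/
def ControlsAbs (ℱ : Filtration ℕ m0) (P : Measure Ω) (f lam : ℕ → Ω → ℝ) : Prop :=
  IsControl ℱ lam ∧ ∀ n, ∀ᵐ ω ∂P, |f n ω| ≤ lam (n - 1) ω

/-! ### The five quasi-norms and the corresponding spaces of martingales -/

/-- `‖f‖_{wH_Φ}`. -/
def normH (Φ : ℝ → ℝ) (P : Measure Ω) (f : ℕ → Ω → ℝ) : ℝ≥0∞ := wnorm Φ P (maxFn f)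

/-- `‖f‖_{wH_Φ^S}`. -/
def normHS (Φ : ℝ → ℝ) (P : Measure Ω) (f : ℕ → Ω → ℝ) : ℝ≥0∞ := wnorm Φ P (sqFn f)

/-- `‖f‖_{wH_Φ^s}`. -/
def normHs (Φ : ℝ → ℝ) (ℱ : Filtration ℕ m0) (P : Measure Ω) (f : ℕ → Ω → ℝ) : ℝ≥0∞ :=
  wnorm Φ P (condSqFn ℱ P f)

/-- `‖f‖_{w𝒬_Φ}`. -/
def normQ (Φ : ℝ → ℝ) (ℱ : Filtration ℕ m0) (P : Measure Ω) (f : ℕ → Ω → ℝ) : ℝ≥0∞ :=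
  ⨅ lam : ℕ → Ω → ℝ, ⨅ _ : ControlsSq ℱ P f lam, wnorm Φ P (controlLim lam)

/-- `‖f‖_{w𝒟_Φ}`. -/
def normD (Φ : ℝ → ℝ) (ℱ : Filtration ℕ m0) (P : Measure Ω) (f : ℕ → Ω → ℝ) : ℝ≥0∞ :=
  ⨅ lam : ℕ → Ω → ℝ, ⨅ _ : ControlsAbs ℱ P f lam, wnorm Φ P (controlLim lam)

/-- The space `wH_Φ`. -/
def spaceH (Φ : ℝ → ℝ) (ℱ : Filtration ℕ m0) (P : Measure Ω) : Set (ℕ → Ω → ℝ) :=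
  {f | Martingale f ℱ P ∧ normH Φ P f < ∞}

/-- The space `wH_Φ^S`. -/
def spaceHS (Φ : ℝ → ℝ) (ℱ : Filtration ℕ m0) (P : Measure Ω) : Set (ℕ → Ω → ℝ) :=
  {f | Martingale f ℱ P ∧ normHS Φ P f < ∞}

/-- The space `wH_Φ^s`. -/
def spaceHs (Φ : ℝ → ℝ) (ℱ : Filtration ℕ m0) (P : Measure Ω) : Set (ℕ → Ω → ℝ) :=
  {f | Martingale f ℱ P ∧ normHs Φ ℱ P f < ∞}

/-- The space `w𝒬_Φ`. -/
def spaceQ (Φ : ℝ → ℝ) (ℱ : Filtration ℕ m0) (P : Measure Ω) : Set (ℕ → Ω → ℝ) :=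
  {f | Martingale f ℱ P ∧
    ∃ lam : ℕ → Ω → ℝ, ControlsSq ℱ P f lam ∧ wnorm Φ P (controlLim lam) < ∞}

/-- The space `w𝒟_Φ`. -/
def spaceD (Φ : ℝ → ℝ) (ℱ : Filtration ℕ m0) (P : Measure Ω) : Set (ℕ → Ω → ℝ) :=
  {f | Martingale f ℱ P ∧
    ∃ lam : ℕ → Ω → ℝ, ControlsAbs ℱ P f lam ∧ wnorm Φ P (controlLim lam) < ∞}

/-- Regularity of the stochastic basis with constant `R`: every `A ∈ ℱ_n` is contained in some
`B ∈ ℱ_{n-1}` with `P(B) ≤ R P(A)` (with `ℱ_{-1} = ℱ_0`, so that `n = 0` is no condition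
when `R ≥ 1`). -/
def IsRegular (ℱ : Filtration ℕ m0) (P : Measure Ω) (R : ℝ≥0) : Prop :=
  ∀ (n : ℕ) (A : Set Ω), MeasurableSet[ℱ n] A →
    ∃ B : Set Ω, MeasurableSet[ℱ (n - 1)] B ∧ A ⊆ B ∧ P B ≤ (R : ℝ≥0∞) * P A

end

end WeakOrlicz

end

/-!
The quasi-norms are compared level by level, by stopping the martingale.

Let `g` be `s(f)`, or the limit `λ_∞` of a control of `f`. For `t > 0` a predictable family of sets
`V_i ∈ ℱ_{i-1}` keeps only the increments of `f` taken before `s(f)`, respectively the control,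
exceeds `t`. The resulting transform (`transform`) agrees with `f` where `g ≤ t`, and the sum of the
second moments of its increments is at most `E min(g, t)²`. Doob's maximal inequality, respectively
Markov's inequality, then shows that `h = M(f), S(f), s(f)` satisfies
`P(h > t) ≤ P(g > t) + t⁻² E min(g, t)²` (`Dominated`). If `Φ(t / c) P(g > t) ≤ 1` for all `t`, the
layer cake formula and the concavity of `Φ` bound the last term by `2 / Φ(t / c)`
(`mul_lintegral_min_sq_le`), so that `Φ(t / c) P(h > t) ≤ 3`. The lower type of `Φ` turns such
constants into a dilation, that is, into a constant factor in the quasi-norm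
(`MemG.exists_wnorm_le`).

The spaces `w𝒬_Φ` and `w𝒟_Φ` are compared by explicit controls: if `λ` controls `S_n(f)`, then
`max_{i ≤ n} |f_i| + λ_n` controls `|f_n|`, and if `λ` controls `|f_n|`, then `S_n(f) + 2 λ_n`
controls `S_n(f)`. The limits of these are at most `M(f) + λ_∞` and `S(f) + 2 λ_∞`.

On a regular basis, an adapted process `X` such as `S_n(f)` or `|f_n|` admits a predictable majorant
(`IsRegular.exists_predictable_majorant`): the event that `X` first exceeds `2 ^ k` at time `n` is
contained in an event of `ℱ_{n-1}` of comparable probability, and the majorant is raised to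
`2 ^ (k + 1)` on it, one step ahead. Its tail at `2 ^ k` is at most
`∑_{j ≥ k} R P(sup X > 2 ^ j)`, which the lower type of `Φ` sums (`MemG.exists_tsum_le`). Hence
`w𝒬_Φ` and `w𝒟_Φ` are bounded by `wH_Φ^S` and `wH_Φ`, which closes the cycle of inequalities.
-/

noncomputable section

namespace WeakOrlicz

/-! ### Scaling properties of `Φ` and of the weak quasi-norm -/

theorem map_mul_le_mul_map_of_concaveOn {Φ : ℝ → ℝ} (hconc : ConcaveOn ℝ (Ici 0) Φ) (h0 : Φ 0 = 0)
    {a r : ℝ} (ha : 1 ≤ a) (hr : 0 ≤ r) : Φ (a * r) ≤ a * Φ r := by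
  have ha0 : 0 < a := by linarith
  have h := hconc.2 (show a * r ∈ Ici 0 from mul_nonneg ha0.le hr) (by simp : (0 : ℝ) ∈ Ici 0)
    (inv_nonneg.2 ha0.le) (sub_nonneg.2 (inv_le_one_of_one_le₀ ha)) (add_sub_cancel a⁻¹ 1)
  simp only [smul_eq_mul, h0, mul_zero, add_zero, inv_mul_cancel_left₀ ha0.ne'] at h
  rwa [inv_mul_le_iff₀ ha0] at h

/-- The lower type of `Φ` absorbs a constant factor `N` into a dilation of the argument. -/
theorem MemG.exists_scale {ℓ : ℝ} (hℓ : 0 < ℓ) (hℓ1 : ℓ ≤ 1) {Φ : ℝ → ℝ} (hΦ : MemG ℓ Φ)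
    {N : ℝ} (hN : 1 ≤ N) : ∃ D : ℝ, 1 ≤ D ∧ ∀ r, 0 ≤ r → N * Φ (r / D) ≤ Φ r := by
  obtain ⟨c, hc1, hc⟩ := hΦ.type_le
  have hNc : 1 ≤ N * c := one_le_mul_of_one_le_of_one_le hN hc1
  have hD1 : 1 ≤ (N * c) ^ (1 / ℓ) := Real.one_le_rpow hNc (by positivity)
  refine ⟨(N * c) ^ (1 / ℓ), hD1, fun r hr => ?_⟩
  set D := (N * c) ^ (1 / ℓ)
  have hD0 : 0 < D := by linarith
  have hDℓ : D ^ ℓ = N * c := by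
    rw [← Real.rpow_mul (by linarith), one_div_mul_cancel hℓ.ne', Real.rpow_one]
  have h := hc D⁻¹ r (by positivity) hr
  have hmax : max (D⁻¹ ^ ℓ) D⁻¹ = (N * c)⁻¹ := by
    rw [max_eq_left, Real.inv_rpow hD0.le, hDℓ]
    conv_lhs => rw [← Real.rpow_one D⁻¹]
    exact Real.rpow_le_rpow_of_exponent_ge (by positivity) (inv_le_one_of_one_le₀ hD1) hℓ1
  rw [hmax] at h
  calc N * Φ (r / D) = N * Φ (D⁻¹ * r) := by rw [div_eq_inv_mul]
    _ ≤ N * (c * (N * c)⁻¹ * Φ r) := by gcongr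
    _ = Φ r := by field_simp

/-- A weak-type estimate for `h` at the scale `c`, with a loss of constants `K` and `N`, bounds the
quasi-norm of `h` by a multiple of `c` that depends only on `Φ`, `K` and `N`. -/
theorem MemG.exists_wnorm_le {ℓ : ℝ} (hℓ : 0 < ℓ) (hℓ1 : ℓ ≤ 1) {Φ : ℝ → ℝ} (hΦ : MemG ℓ Φ)
    {K N : ℝ} (hK : 1 ≤ K) (hN : 1 ≤ N) :
    ∃ C : ℝ≥0, 0 < C ∧ ∀ (Ω : Type u) (_ : MeasurableSpace Ω) (P : Measure Ω) (h : Ω → ℝ≥0∞)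
      (c : ℝ), 0 < c → (∀ t : ℝ, 0 < t → ENNReal.ofReal (Φ (t / c)) *
        P {ω | ENNReal.ofReal (K * t) < h ω} ≤ ENNReal.ofReal N) →
      wnorm Φ P h ≤ C * ENNReal.ofReal c := by
  obtain ⟨D, hD1, hD⟩ := hΦ.exists_scale hℓ hℓ1 hN
  have hK0 : 0 < K := by linarith
  have hD0 : 0 < D := by linarith
  have hN0 : 0 < N := by linarith
  refine ⟨(K * D).toNNReal, by simpa using mul_pos hK0 hD0, fun Ω m0 P h c hc hb => ?_⟩
  refine sInf_le ⟨K * D * c, by positivity, ?_, fun t ht => ?_⟩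
  · rw [ENNReal.ofReal_mul (by positivity)]; rfl
  have h1 := hb (t / K) (by positivity)
  rw [mul_div_cancel₀ _ hK0.ne'] at h1
  have h2 := hD (t / K / c) (by positivity)
  rw [show t / K / c / D = t / (K * D * c) by field_simp] at h2
  have h3 : ENNReal.ofReal N * (ENNReal.ofReal (Φ (t / (K * D * c))) *
      P {ω | ENNReal.ofReal t < h ω}) ≤ ENNReal.ofReal N * 1 := by
    rw [← mul_assoc, ← ENNReal.ofReal_mul hN0.le, mul_one]
    exact (mul_le_mul_left (ENNReal.ofReal_le_ofReal h2) _).trans h1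
  exact (ENNReal.mul_le_mul_iff_right (by simpa using hN0) ENNReal.ofReal_ne_top).1 h3

section

variable {Ω : Type u} {m0 : MeasurableSpace Ω} {P : Measure Ω}

theorem le_mul_wnorm {Φ : ℝ → ℝ} {g : Ω → ℝ≥0∞} {C : ℝ≥0} (hC : 0 < C) {x : ℝ≥0∞}
    (h : ∀ c : ℝ, 0 < c → (∀ t : ℝ, 0 < t → ENNReal.ofReal (Φ (t / c)) *
      P {ω | ENNReal.ofReal t < g ω} ≤ 1) → x ≤ C * ENNReal.ofReal c) :
    x ≤ C * wnorm Φ P g := by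
  rw [mul_comm, ← ENNReal.div_le_iff (by simpa using hC.ne') ENNReal.coe_ne_top]
  refine le_sInf ?_
  rintro _ ⟨c, hc, rfl, hb⟩
  rw [ENNReal.div_le_iff (by simpa using hC.ne') ENNReal.coe_ne_top, mul_comm]
  exact h c hc hb

/-- The second moment of a truncated function in the weak Orlicz class, by the layer cake formula
and `u / Φ (u / c) ≤ t / Φ (t / c)` for `u ≤ t`. -/
theorem mul_lintegral_min_sq_le {Φ : ℝ → ℝ} (hconc : ConcaveOn ℝ (Ici 0) Φ) (h0 : Φ 0 = 0)
    {g : Ω → ℝ≥0∞} (hg : AEMeasurable g P) {c : ℝ} (hc : 0 < c)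
    (hb : ∀ t : ℝ, 0 < t → ENNReal.ofReal (Φ (t / c)) * P {ω | ENNReal.ofReal t < g ω} ≤ 1)
    {t : ℝ} (ht : 0 < t) :
    ENNReal.ofReal (Φ (t / c)) * ∫⁻ ω, min (g ω) (ENNReal.ofReal t) ^ 2 ∂P
      ≤ 2 * ENNReal.ofReal t ^ 2 := by
  set φ : Ω → ℝ := fun ω => (min (g ω) (ENNReal.ofReal t)).toReal with hφ
  have hfin : ∀ ω, min (g ω) (ENNReal.ofReal t) ≠ ∞ := fun ω =>
    (min_lt_of_right_lt ENNReal.ofReal_lt_top).ne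
  have hφm : AEMeasurable φ P := (hg.min aemeasurable_const).ennreal_toReal
  have e1 : ∫⁻ ω, min (g ω) (ENNReal.ofReal t) ^ 2 ∂P =
      ∫⁻ ω, ENNReal.ofReal (φ ω ^ (2 : ℝ)) ∂P := by
    refine lintegral_congr fun ω => ?_
    rw [Real.rpow_two, ENNReal.ofReal_pow ENNReal.toReal_nonneg,
      ENNReal.ofReal_toReal (hfin ω)]
  have key : ∀ u ∈ Ioi (0 : ℝ), ENNReal.ofReal (Φ (t / c)) *
      (P {ω | u < φ ω} * ENNReal.ofReal (u ^ ((2 : ℝ) - 1)))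
      ≤ (Iio t).indicator (fun _ => ENNReal.ofReal t) u := by
    intro u hu
    have hu : 0 < u := hu
    rw [show (2 : ℝ) - 1 = 1 by norm_num, Real.rpow_one]
    by_cases hut : u < t
    · have hsub : {ω | u < φ ω} ⊆ {ω | ENNReal.ofReal u < g ω} := fun ω (hω : u < φ ω) => by
        have := (ENNReal.ofReal_lt_iff_lt_toReal hu.le (hfin ω)).2 hω
        exact this.trans_le (min_le_left _ _)
      have hΦ : Φ (t / c) * u ≤ t * Φ (u / c) := by
        have := map_mul_le_mul_map_of_concaveOn hconc h0 (a := t / u) (r := u / c)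
          ((one_le_div hu).2 hut.le) (by positivity)
        rw [show t / u * (u / c) = t / c by field_simp, div_mul_eq_mul_div, le_div_iff₀ hu] at this
        exact this
      rw [indicator_of_mem (by exact hut)]
      calc _ ≤ ENNReal.ofReal (Φ (t / c)) *
            (P {ω | ENNReal.ofReal u < g ω} * ENNReal.ofReal u) := by gcongr
        _ = ENNReal.ofReal (Φ (t / c) * u) * P {ω | ENNReal.ofReal u < g ω} := by
          rw [ENNReal.ofReal_mul' hu.le]; ring
        _ ≤ ENNReal.ofReal (t * Φ (u / c)) * P {ω | ENNReal.ofReal u < g ω} := by gcongr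
        _ = ENNReal.ofReal t * (ENNReal.ofReal (Φ (u / c)) *
              P {ω | ENNReal.ofReal u < g ω}) := by
          rw [ENNReal.ofReal_mul ht.le]; ring
        _ ≤ ENNReal.ofReal t * 1 := by gcongr; exact hb u hu
        _ = _ := mul_one _
    · have : {ω | u < φ ω} = ∅ := by
        ext ω
        simp only [mem_ofPred_eq, mem_empty_iff_false, iff_false, not_lt]
        refine le_trans ?_ (not_lt.1 hut)
        exact ENNReal.toReal_le_of_le_ofReal ht.le (min_le_right _ _)
      simp [this]
  rw [e1, lintegral_rpow_eq_lintegral_meas_lt_mul P (ae_of_all _ fun _ => ENNReal.toReal_nonneg)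
    hφm two_pos, mul_left_comm, ← lintegral_const_mul' _ _ ENNReal.ofReal_ne_top]
  calc _ ≤ ENNReal.ofReal 2 * ∫⁻ u in Ioi (0 : ℝ),
        (Iio t).indicator (fun _ => ENNReal.ofReal t) u := by
        exact mul_le_mul_right (setLIntegral_mono' measurableSet_Ioi key) _
    _ = _ := by
        rw [lintegral_indicator_const measurableSet_Iio, Measure.restrict_apply measurableSet_Iio,
          inter_comm, Ioi_inter_Iio, Real.volume_Ioo, sub_zero, ← sq]
        simp

end

/-! ### Martingale transforms by predictable sets -/

section

variable {Ω : Type u} {m0 : MeasurableSpace Ω} {P : Measure Ω} {ℱ : Filtration ℕ m0}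
  {f : ℕ → Ω → ℝ}

/-- The increments `1_{V_i} df_i` of the transform of `f` by the sets `V_i`. -/
def tdiff (f : ℕ → Ω → ℝ) (V : ℕ → Set Ω) (i : ℕ) : Ω → ℝ := (V i).indicator (mdiff f i)

/-- The transform `∑_{i ≤ n} 1_{V_i} df_i`. When `V_i` is the event that a stopping condition
has not occurred before time `i`, this is the stopped process, set to `0` where the condition
occurs at the very beginning. -/
def transform (f : ℕ → Ω → ℝ) (V : ℕ → Set Ω) (n : ℕ) (ω : Ω) : ℝ :=
  ∑ i ∈ Finset.range (n + 1), tdiff f V i ω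

theorem transform_succ (V : ℕ → Set Ω) (n : ℕ) :
    transform f V (n + 1) = transform f V n + tdiff f V (n + 1) := by
  ext ω
  simp [transform, Finset.sum_range_succ _ (n + 1)]

theorem sum_mdiff (f : ℕ → Ω → ℝ) (n : ℕ) (ω : Ω) :
    ∑ i ∈ Finset.range (n + 1), mdiff f i ω = f n ω := by
  induction n with
  | zero => simp [mdiff]
  | succ n ih => rw [Finset.sum_range_succ, ih]; simp [mdiff]

theorem transform_eq {V : ℕ → Set Ω} {n : ℕ} {ω : Ω} (h : ∀ i ≤ n, ω ∈ V i) :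
    transform f V n ω = f n ω := by
  rw [← sum_mdiff f n ω]
  refine Finset.sum_congr rfl fun i hi => ?_
  exact indicator_of_mem (h i (Finset.mem_range_succ_iff.1 hi)) _

theorem stronglyMeasurable_mdiff (hf : StronglyAdapted ℱ f) (i : ℕ) :
    StronglyMeasurable[ℱ i] (mdiff f i) := by
  cases i with
  | zero => exact hf 0
  | succ n => exact (hf (n + 1)).sub ((hf n).mono (ℱ.mono n.le_succ))

theorem integrable_mdiff (hf : Martingale f ℱ P) (i : ℕ) : Integrable (mdiff f i) P := by
  cases i with
  | zero => exact hf.integrable 0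
  | succ n => exact (hf.integrable _).sub (hf.integrable _)

theorem measurable_enorm_mdiff_sq (hf : StronglyAdapted ℱ f) (i : ℕ) :
    Measurable[ℱ i] fun ω => ‖mdiff f i ω‖ₑ ^ 2 :=
  (stronglyMeasurable_mdiff hf i).enorm.pow_const 2

theorem stronglyMeasurable_tdiff (hf : StronglyAdapted ℱ f) {V : ℕ → Set Ω}
    (hV : ∀ i, MeasurableSet[ℱ (i - 1)] (V i)) (i : ℕ) :
    StronglyMeasurable[ℱ i] (tdiff f V i) :=
  (stronglyMeasurable_mdiff hf i).indicator (ℱ.mono (Nat.sub_le i 1) _ (hV i))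

theorem stronglyAdapted_transform (hf : StronglyAdapted ℱ f) {V : ℕ → Set Ω}
    (hV : ∀ i, MeasurableSet[ℱ (i - 1)] (V i)) : StronglyAdapted ℱ (transform f V) := fun _ =>
  Finset.stronglyMeasurable_fun_sum _ fun i hi =>
    (stronglyMeasurable_tdiff hf hV i).mono (ℱ.mono (Finset.mem_range_succ_iff.1 hi))

theorem condExp_tdiff [IsFiniteMeasure P] (hf : Martingale f ℱ P) {V : ℕ → Set Ω}
    (hV : ∀ i, MeasurableSet[ℱ (i - 1)] (V i)) (n : ℕ) :
    P[tdiff f V (n + 1) | ℱ n] =ᵐ[P] 0 := by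
  have h1 := condExp_indicator (integrable_mdiff hf (n + 1)) (hV (n + 1))
  have h2 : P[mdiff f (n + 1) | ℱ n] =ᵐ[P] 0 := by
    have := condExp_sub (hf.integrable (n + 1)) (hf.integrable n) (ℱ n)
    filter_upwards [this, hf.2 n (n + 1) n.le_succ, hf.2 n n le_rfl] with ω h3 h4 h5
    change P[f (n + 1) - f n | ℱ n] ω = 0
    rw [h3, Pi.sub_apply, h4, h5, sub_self]
  filter_upwards [h1, h2] with ω h3 h4
  change P[(V (n + 1)).indicator (mdiff f (n + 1)) | ℱ n] ω = 0
  rw [show ℱ n = ℱ (n + 1 - 1) from rfl, h3]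
  exact indicator_apply_eq_zero.2 fun _ => h4

theorem memLp_transform {V : ℕ → Set Ω} (hL : ∀ i, MemLp (tdiff f V i) 2 P) (n : ℕ) :
    MemLp (transform f V n) 2 P :=
  memLp_finsetSum _ fun i _ => hL i

theorem condExp_transform_mul_tdiff [IsFiniteMeasure P] (hf : Martingale f ℱ P) {V : ℕ → Set Ω}
    (hV : ∀ i, MeasurableSet[ℱ (i - 1)] (V i)) (hL : ∀ i, MemLp (tdiff f V i) 2 P) (n : ℕ) :
    P[transform f V n * tdiff f V (n + 1) | ℱ n] =ᵐ[P] 0 := by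
  refine (condExp_mul_of_stronglyMeasurable_left (stronglyAdapted_transform hf.1 hV n)
    ((memLp_transform hL n).integrable_mul (hL (n + 1)))
    ((hL (n + 1)).integrable one_le_two)).trans ?_
  filter_upwards [condExp_tdiff hf hV n] with ω h
  simp [h]

theorem transform_sq_succ_sub (V : ℕ → Set Ω) (n : ℕ) :
    transform f V (n + 1) ^ 2 - transform f V n ^ 2 =
      tdiff f V (n + 1) ^ 2 + (2 : ℝ) • (transform f V n * tdiff f V (n + 1)) := by
  rw [transform_succ]
  ext ω
  simp only [Pi.add_apply, Pi.sub_apply, Pi.mul_apply, Pi.pow_apply, Pi.smul_apply, smul_eq_mul]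
  ring

theorem submartingale_transform_sq [IsFiniteMeasure P] (hf : Martingale f ℱ P) {V : ℕ → Set Ω}
    (hV : ∀ i, MeasurableSet[ℱ (i - 1)] (V i)) (hL : ∀ i, MemLp (tdiff f V i) 2 P) :
    Submartingale (fun n => transform f V n ^ 2) ℱ P := by
  refine submartingale_of_condExp_sub_nonneg_nat
    (fun n => (stronglyAdapted_transform hf.1 hV n).pow 2)
    (fun n => (memLp_transform hL n).integrable_sq) fun n => ?_
  rw [transform_sq_succ_sub]
  have hmul : Integrable (transform f V n * tdiff f V (n + 1)) P :=
    (memLp_transform hL n).integrable_mul (hL (n + 1))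
  have h1 := condExp_add (m := ℱ n) (hL (n + 1)).integrable_sq (hmul.smul (2 : ℝ))
  have h2 := condExp_smul (μ := P) (2 : ℝ) (transform f V n * tdiff f V (n + 1)) (ℱ n)
  have h3 : 0 ≤ᵐ[P] P[tdiff f V (n + 1) ^ 2 | ℱ n] :=
    condExp_nonneg (ae_of_all _ fun ω => sq_nonneg (tdiff f V (n + 1) ω))
  filter_upwards [h1, h2, h3, condExp_transform_mul_tdiff hf hV hL n] with ω e1 e2 e3 e4
  change 0 ≤ P[tdiff f V (n + 1) ^ 2 + (2 : ℝ) • (transform f V n * tdiff f V (n + 1)) | ℱ n] ω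
  have e1' : P[tdiff f V (n + 1) ^ 2 + (2 : ℝ) • (transform f V n * tdiff f V (n + 1)) | ℱ n] ω =
    P[tdiff f V (n + 1) ^ 2 | ℱ n] ω +
      P[(2 : ℝ) • (transform f V n * tdiff f V (n + 1)) | ℱ n] ω := e1
  rw [e1', e2, Pi.smul_apply, e4]
  simpa using e3

theorem lintegral_enorm_sq {g : Ω → ℝ} (hg : MemLp g 2 P) :
    ∫⁻ ω, ‖g ω‖ₑ ^ 2 ∂P = ENNReal.ofReal (∫ ω, (g ^ 2) ω ∂P) := by
  have hsq : Integrable (g ^ 2) P := hg.integrable_sq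
  rw [ofReal_integral_eq_lintegral_ofReal hsq (ae_of_all _ fun ω => sq_nonneg (g ω))]
  refine lintegral_congr fun ω => ?_
  rw [Pi.pow_apply, ← sq_abs, ENNReal.ofReal_pow (abs_nonneg _), ← Real.norm_eq_abs,
    ofReal_norm]

/-- Orthogonality of the martingale increments. -/
theorem lintegral_transform_sq [IsFiniteMeasure P] (hf : Martingale f ℱ P) {V : ℕ → Set Ω}
    (hV : ∀ i, MeasurableSet[ℱ (i - 1)] (V i)) (hL : ∀ i, MemLp (tdiff f V i) 2 P) (n : ℕ) :
    ∫⁻ ω, ‖transform f V n ω‖ₑ ^ 2 ∂P =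
      ∑ i ∈ Finset.range (n + 1), ∫⁻ ω, ‖tdiff f V i ω‖ₑ ^ 2 ∂P := by
  induction n with
  | zero => simp [transform]
  | succ n ih =>
    have hmul : Integrable (transform f V n * tdiff f V (n + 1)) P :=
      (memLp_transform hL n).integrable_mul (hL (n + 1))
    have h0 : ∫ ω, (transform f V n * tdiff f V (n + 1)) ω ∂P = 0 := by
      rw [← integral_condExp (ℱ.le n),
        integral_congr_ae (condExp_transform_mul_tdiff hf hV hL n)]
      simp
    have h1 : transform f V (n + 1) ^ 2 = transform f V n ^ 2 + (tdiff f V (n + 1) ^ 2 +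
        (2 : ℝ) • (transform f V n * tdiff f V (n + 1))) := by
      rw [← transform_sq_succ_sub]; ring
    have hsq : ∀ {g : Ω → ℝ}, MemLp g 2 P → Integrable (g ^ 2) P := fun hg => hg.integrable_sq
    have hnn : ∀ g : Ω → ℝ, 0 ≤ ∫ ω, (g ^ 2) ω ∂P := fun g =>
      integral_nonneg fun ω => sq_nonneg (g ω)
    rw [Finset.sum_range_succ, ← ih, lintegral_enorm_sq (memLp_transform hL _),
      lintegral_enorm_sq (memLp_transform hL _), lintegral_enorm_sq (hL _),
      ← ENNReal.ofReal_add (hnn _) (hnn _), h1,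
      integral_add' (hsq (memLp_transform hL n)) ((hsq (hL (n + 1))).add (hmul.smul (2 : ℝ))),
      integral_add' (hsq (hL (n + 1))) (hmul.smul (2 : ℝ))]
    simp only [Pi.smul_apply, integral_smul, h0, smul_zero, add_zero]

/-- Doob's maximal inequality in `L²` for the transform. -/
theorem measure_exists_lt_transform_le [IsFiniteMeasure P] (hf : Martingale f ℱ P)
    {V : ℕ → Set Ω} (hV : ∀ i, MeasurableSet[ℱ (i - 1)] (V i))
    (hL : ∀ i, MemLp (tdiff f V i) 2 P) {t : ℝ} (ht : 0 < t) :
    P {ω | ∃ n, t < |transform f V n ω|} ≤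
      (∑' i, ∫⁻ ω, ‖tdiff f V i ω‖ₑ ^ 2 ∂P) / ENNReal.ofReal t ^ 2 := by
  set A : ℕ → Set Ω := fun n => {ω | ∃ k ≤ n, t < |transform f V k ω|} with hA
  have hmono : Monotone A := fun a b hab ω ⟨k, hk, h⟩ => ⟨k, hk.trans hab, h⟩
  have hU : {ω | ∃ n, t < |transform f V n ω|} = ⋃ n, A n := by
    ext ω
    simp only [hA, mem_ofPred_eq, mem_iUnion]
    exact ⟨fun ⟨n, h⟩ => ⟨n, n, le_rfl, h⟩, fun ⟨_, k, _, h⟩ => ⟨k, h⟩⟩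
  rw [hU, hmono.measure_iUnion]
  refine iSup_le fun n => ?_
  rw [ENNReal.le_div_iff_mul_le (Or.inl (by simpa using ht)) (Or.inl (by simp)), mul_comm]
  have hmax := maximal_ineq (submartingale_transform_sq hf hV hL)
    (fun n ω => sq_nonneg (transform f V n ω)) (ε := (t ^ 2).toNNReal) n
  have hε : ((t ^ 2).toNNReal : ℝ) = t ^ 2 := Real.coe_toNNReal _ (sq_nonneg t)
  have hε' : (((t ^ 2).toNNReal : ℝ≥0) : ℝ≥0∞) = ENNReal.ofReal t ^ 2 := by
    rw [← ENNReal.ofReal_pow ht.le]; rfl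
  rw [hε, hε'] at hmax
  calc ENNReal.ofReal t ^ 2 * P (A n) ≤ ENNReal.ofReal t ^ 2 *
        P {ω | t ^ 2 ≤ (Finset.range (n + 1)).sup' Finset.nonempty_range_add_one
          fun k => (transform f V k ^ 2) ω} := by
        gcongr
        rintro ω ⟨k, hk, h⟩
        refine le_trans ?_ (Finset.le_sup' (fun k => (transform f V k ^ 2) ω)
          (Finset.mem_range_succ_iff.2 hk))
        rw [Pi.pow_apply, ← sq_abs (transform f V k ω)]
        gcongr
    _ ≤ _ := hmax
    _ ≤ ENNReal.ofReal (∫ ω, (transform f V n ^ 2) ω ∂P) :=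
        ENNReal.ofReal_le_ofReal (setIntegral_le_integral (memLp_transform hL n).integrable_sq
          (ae_of_all _ fun ω => sq_nonneg (transform f V n ω)))
    _ = ∑ i ∈ Finset.range (n + 1), ∫⁻ ω, ‖tdiff f V i ω‖ₑ ^ 2 ∂P := by
        rw [← lintegral_enorm_sq (memLp_transform hL n), lintegral_transform_sq hf hV hL]
    _ ≤ _ := ENNReal.sum_le_tsum _

theorem memLp_two_of_lintegral_ne_top {g : Ω → ℝ} (hg : AEStronglyMeasurable g P)
    (h : ∫⁻ ω, ‖g ω‖ₑ ^ 2 ∂P ≠ ∞) : MemLp g 2 P := by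
  refine ⟨hg, ?_⟩
  rw [eLpNorm_lt_top_iff_lintegral_rpow_enorm_lt_top (by simp) (by simp)]
  simpa using h.lt_top

theorem lt_rpow_half_iff {a x : ℝ≥0∞} : a < x ^ (1 / 2 : ℝ) ↔ a ^ 2 < x := by
  rw [one_div, ENNReal.lt_rpow_inv_iff two_pos, ENNReal.rpow_two]

theorem rpow_half_le_iff {a x : ℝ≥0∞} : x ^ (1 / 2 : ℝ) ≤ a ↔ x ≤ a ^ 2 := by
  rw [one_div, ENNReal.rpow_inv_le_iff two_pos, ENNReal.rpow_two]

theorem enorm_tdiff_sq (V : ℕ → Set Ω) (i : ℕ) (ω : Ω) :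
    ‖tdiff f V i ω‖ₑ ^ 2 = (V i).indicator (fun ω => ‖mdiff f i ω‖ₑ ^ 2) ω := by
  by_cases h : ω ∈ V i <;> simp [tdiff, h]

/-- Splitting a level set according to whether some predictable condition `V i` fails. -/
theorem measure_le_of_forall_mem {V : ℕ → Set Ω} {A B : Set Ω} {x : ℝ≥0∞} (hB : P B ≤ x)
    (h : ∀ ω ∈ A, (∀ i, ω ∈ V i) → ω ∈ B) : P A ≤ P (⋃ i, (V i)ᶜ) + x := by
  refine (measure_mono fun ω hω => ?_).trans ((measure_union_le _ B).trans (by gcongr))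
  by_cases hV : ∀ i, ω ∈ V i
  · exact Or.inr (h ω hω hV)
  · push Not at hV
    exact Or.inl (mem_iUnion.2 hV)

theorem measure_lt_maxFn_le [IsFiniteMeasure P] (hf : Martingale f ℱ P) {V : ℕ → Set Ω}
    (hV : ∀ i, MeasurableSet[ℱ (i - 1)] (V i)) {t : ℝ} (ht : 0 < t) :
    P {ω | ENNReal.ofReal t < maxFn f ω} ≤ P (⋃ i, (V i)ᶜ) +
      (∑' i, ∫⁻ ω, ‖tdiff f V i ω‖ₑ ^ 2 ∂P) / ENNReal.ofReal t ^ 2 := by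
  by_cases hG : ∑' i, ∫⁻ ω, ‖tdiff f V i ω‖ₑ ^ 2 ∂P = ∞
  · rw [hG, ENNReal.top_div_of_ne_top (by simp), add_top]
    exact le_top
  have hL : ∀ i, MemLp (tdiff f V i) 2 P := fun i => memLp_two_of_lintegral_ne_top
    ((stronglyMeasurable_tdiff hf.1 hV i).mono (ℱ.le i)).aestronglyMeasurable
    (ENNReal.ne_top_of_tsum_ne_top hG i)
  refine measure_le_of_forall_mem (measure_exists_lt_transform_le hf hV hL ht) fun ω hω hmem => ?_
  obtain ⟨n, hn⟩ := lt_iSup_iff.1 (show ENNReal.ofReal t < ⨆ i, ‖f i ω‖ₑ from hω)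
  refine ⟨n, ?_⟩
  rw [transform_eq fun i _ => hmem i]
  rw [← ofReal_norm] at hn
  exact (ENNReal.ofReal_lt_ofReal_iff_of_nonneg ht.le).1 hn

/-- Markov's inequality for a square function. -/
theorem measure_lt_tsum_rpow_half_le {V : ℕ → Set Ω} (hV : ∀ i, MeasurableSet (V i))
    {a : ℕ → Ω → ℝ≥0∞} (ha : ∀ i, Measurable (a i)) {t : ℝ} (ht : 0 < t) :
    P {ω | ENNReal.ofReal t < (∑' i, a i ω) ^ (1 / 2 : ℝ)} ≤ P (⋃ i, (V i)ᶜ) +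
      (∑' i, ∫⁻ ω, (V i).indicator (a i) ω ∂P) / ENNReal.ofReal t ^ 2 := by
  have hm : ∀ i, Measurable ((V i).indicator (a i)) := fun i => (ha i).indicator (hV i)
  rw [← lintegral_tsum fun i => (hm i).aemeasurable]
  refine measure_le_of_forall_mem (meas_ge_le_lintegral_div
    (Measurable.tsum hm).aemeasurable (by simpa using ht) (by simp)) fun ω hω hmem => ?_
  have h : ENNReal.ofReal t < (∑' i, a i ω) ^ (1 / 2 : ℝ) := hω
  rw [lt_rpow_half_iff] at h
  change ENNReal.ofReal t ^ 2 ≤ ∑' i, (V i).indicator (a i) ω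
  simpa only [fun i => indicator_of_mem (hmem i) (a i)] using h.le

theorem measure_lt_sqFn_le (hf : StronglyAdapted ℱ f) {V : ℕ → Set Ω}
    (hV : ∀ i, MeasurableSet[ℱ (i - 1)] (V i)) {t : ℝ} (ht : 0 < t) :
    P {ω | ENNReal.ofReal t < sqFn f ω} ≤ P (⋃ i, (V i)ᶜ) +
      (∑' i, ∫⁻ ω, ‖tdiff f V i ω‖ₑ ^ 2 ∂P) / ENNReal.ofReal t ^ 2 := by
  simp only [enorm_tdiff_sq]
  exact measure_lt_tsum_rpow_half_le (fun i => ℱ.le _ _ (hV i))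
    (fun i => (measurable_enorm_mdiff_sq hf i).mono (ℱ.le i) le_rfl) ht

theorem lintegral_indicator_condLExp [IsFiniteMeasure P] {V : ℕ → Set Ω}
    (hV : ∀ i, MeasurableSet[ℱ (i - 1)] (V i)) (i : ℕ) :
    ∫⁻ ω, (V i).indicator (condLExp (ℱ (i - 1)) P fun ω' => ‖mdiff f i ω'‖ₑ ^ 2) ω ∂P =
      ∫⁻ ω, ‖tdiff f V i ω‖ₑ ^ 2 ∂P := by
  simp only [enorm_tdiff_sq]
  rw [lintegral_indicator (ℱ.le _ _ (hV i)), lintegral_indicator (ℱ.le _ _ (hV i)),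
    setLIntegral_condLExp (ℱ.le _) P _ (hV i)]

theorem measure_lt_condSqFn_le [IsFiniteMeasure P] {V : ℕ → Set Ω}
    (hV : ∀ i, MeasurableSet[ℱ (i - 1)] (V i)) {t : ℝ} (ht : 0 < t) :
    P {ω | ENNReal.ofReal t < condSqFn ℱ P f ω} ≤ P (⋃ i, (V i)ᶜ) +
      (∑' i, ∫⁻ ω, ‖tdiff f V i ω‖ₑ ^ 2 ∂P) / ENNReal.ofReal t ^ 2 := by
  simp only [← lintegral_indicator_condLExp hV]
  exact measure_lt_tsum_rpow_half_le (fun i => ℱ.le _ _ (hV i))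
    (fun i => measurable_condLExp' _ _ _) ht

end

/-! ### Domination of a function by the level sets and truncations of another -/

section

variable {Ω : Type u} {m0 : MeasurableSpace Ω} {P : Measure Ω} {ℱ : Filtration ℕ m0}
  {f : ℕ → Ω → ℝ}

/-- `h` is dominated by `g` if `P(h > t) ≤ P(g > t) + t⁻² E min(g, t)²` for all `t > 0`. -/
def Dominated (P : Measure Ω) (h g : Ω → ℝ≥0∞) : Prop :=
  ∀ t : ℝ, 0 < t → P {ω | ENNReal.ofReal t < h ω} ≤ P {ω | ENNReal.ofReal t < g ω} +
    (∫⁻ ω, min (g ω) (ENNReal.ofReal t) ^ 2 ∂P) / ENNReal.ofReal t ^ 2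

theorem Dominated.mul_measure_le {h g : Ω → ℝ≥0∞} (hd : Dominated P h g) {Φ : ℝ → ℝ}
    (hconc : ConcaveOn ℝ (Ici 0) Φ) (h0 : Φ 0 = 0) (hg : AEMeasurable g P) {c : ℝ} (hc : 0 < c)
    (hb : ∀ t : ℝ, 0 < t → ENNReal.ofReal (Φ (t / c)) * P {ω | ENNReal.ofReal t < g ω} ≤ 1)
    {t : ℝ} (ht : 0 < t) :
    ENNReal.ofReal (Φ (t / c)) * P {ω | ENNReal.ofReal t < h ω} ≤ 3 := by
  have ht2 : ENNReal.ofReal t ^ 2 ≠ 0 := by simpa using ht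
  calc _ ≤ ENNReal.ofReal (Φ (t / c)) * (P {ω | ENNReal.ofReal t < g ω} +
      (∫⁻ ω, min (g ω) (ENNReal.ofReal t) ^ 2 ∂P) / ENNReal.ofReal t ^ 2) := by
        gcongr; exact hd t ht
    _ = ENNReal.ofReal (Φ (t / c)) * P {ω | ENNReal.ofReal t < g ω} +
      ENNReal.ofReal (Φ (t / c)) * (∫⁻ ω, min (g ω) (ENNReal.ofReal t) ^ 2 ∂P) /
        ENNReal.ofReal t ^ 2 := by rw [mul_add, mul_div_assoc]
    _ ≤ 1 + 2 * ENNReal.ofReal t ^ 2 / ENNReal.ofReal t ^ 2 :=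
        add_le_add (hb t ht)
          (ENNReal.div_le_div_right (mul_lintegral_min_sq_le hconc h0 hg hc hb ht) _)
    _ = 3 := by
        rw [ENNReal.mul_div_cancel_right ht2 (by simp)]
        norm_num

theorem dominated_of_transform [IsFiniteMeasure P] (hf : Martingale f ℱ P) {g : Ω → ℝ≥0∞}
    {V : ℝ → ℕ → Set Ω} (hV : ∀ t i, MeasurableSet[ℱ (i - 1)] (V t i))
    (hsub : ∀ t, 0 < t → ⋃ i, (V t i)ᶜ ⊆ {ω | ENNReal.ofReal t < g ω})
    (hG : ∀ t, 0 < t → ∑' i, ∫⁻ ω, ‖tdiff f (V t) i ω‖ₑ ^ 2 ∂P ≤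
      ∫⁻ ω, min (g ω) (ENNReal.ofReal t) ^ 2 ∂P) :
    Dominated P (maxFn f) g ∧ Dominated P (sqFn f) g ∧ Dominated P (condSqFn ℱ P f) g := by
  have key : ∀ t, 0 < t → P (⋃ i, (V t i)ᶜ) +
      (∑' i, ∫⁻ ω, ‖tdiff f (V t) i ω‖ₑ ^ 2 ∂P) / ENNReal.ofReal t ^ 2 ≤
      P {ω | ENNReal.ofReal t < g ω} +
        (∫⁻ ω, min (g ω) (ENNReal.ofReal t) ^ 2 ∂P) / ENNReal.ofReal t ^ 2 := fun t ht => by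
    gcongr
    · exact hsub t ht
    · exact hG t ht
  exact ⟨fun t ht => (measure_lt_maxFn_le hf (hV t) ht).trans (key t ht),
    fun t ht => (measure_lt_sqFn_le hf.1 (hV t) ht).trans (key t ht),
    fun t ht => (measure_lt_condSqFn_le (hV t) ht).trans (key t ht)⟩

theorem tsum_indicator_le {V : ℕ → Set Ω} {a : ℕ → Ω → ℝ≥0∞} {ω : Ω} {T : ℝ≥0∞}
    (h : ∀ n, ω ∈ V n → ∑ i ∈ Finset.range (n + 1), a i ω ≤ T) :
    ∑' i, (V i).indicator (a i) ω ≤ T := by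
  refine ENNReal.tsum_le_of_sum_range_le fun n => ?_
  induction n with
  | zero => simp
  | succ n ih =>
    by_cases hn : ω ∈ V n
    · exact (Finset.sum_le_sum fun i _ => indicator_le_self _ _ _).trans (h n hn)
    · rwa [Finset.sum_range_succ, indicator_of_notMem hn, add_zero]

theorem tsum_lintegral_indicator_le {V : ℕ → Set Ω} (hV : ∀ i, MeasurableSet (V i))
    {a : ℕ → Ω → ℝ≥0∞} (ha : ∀ i, Measurable (a i)) {T : Ω → ℝ≥0∞}
    (h : ∀ᵐ ω ∂P, ∀ n, ω ∈ V n → ∑ i ∈ Finset.range (n + 1), a i ω ≤ T ω) :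
    ∑' i, ∫⁻ ω, (V i).indicator (a i) ω ∂P ≤ ∫⁻ ω, T ω ∂P := by
  rw [← lintegral_tsum fun i => ((ha i).indicator (hV i)).aemeasurable]
  refine lintegral_mono_ae ?_
  filter_upwards [h] with ω hω using tsum_indicator_le hω

/-- The maximal function and the quadratic variation are dominated by the conditional quadratic
variation: the transform stops `f` just before its conditional quadratic variation exceeds `t`. -/
theorem dominated_condSqFn [IsFiniteMeasure P] (hf : Martingale f ℱ P) :
    Dominated P (maxFn f) (condSqFn ℱ P f) ∧ Dominated P (sqFn f) (condSqFn ℱ P f) := by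
  set a : ℕ → Ω → ℝ≥0∞ := fun i => condLExp (ℱ (i - 1)) P fun ω' => ‖mdiff f i ω'‖ₑ ^ 2 with ha
  set V : ℝ → ℕ → Set Ω :=
    fun t n => {ω | ∑ i ∈ Finset.range (n + 1), a i ω ≤ ENNReal.ofReal t ^ 2} with hVdef
  have hV : ∀ t i, MeasurableSet[ℱ (i - 1)] (V t i) := fun t n => by
    have hm : Measurable[ℱ (n - 1)] fun ω => ∑ i ∈ Finset.range (n + 1), a i ω :=
      Finset.measurable_fun_sum _ fun i hi => (measurable_condLExp _ _ _).mono
        (ℱ.mono (Nat.sub_le_sub_right (Finset.mem_range_succ_iff.1 hi) 1)) le_rfl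
    exact hm measurableSet_Iic
  have hs : ∀ ω, condSqFn ℱ P f ω = (∑' i, a i ω) ^ (1 / 2 : ℝ) := fun ω => rfl
  refine And.imp_right And.left (dominated_of_transform hf hV (fun t ht ω hω => ?_) fun t ht => ?_)
  · obtain ⟨n, hn⟩ := mem_iUnion.1 hω
    have hn : ENNReal.ofReal t ^ 2 < ∑ i ∈ Finset.range (n + 1), a i ω := not_le.1 hn
    rw [mem_ofPred_eq, hs, lt_rpow_half_iff]
    exact hn.trans_le (ENNReal.sum_le_tsum _)
  · simp only [← lintegral_indicator_condLExp (hV t)]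
    refine tsum_lintegral_indicator_le (fun i => ℱ.le _ _ (hV t i))
      (fun i => measurable_condLExp' _ _ _) (ae_of_all _ fun ω n hn => ?_)
    rw [← rpow_half_le_iff]
    refine le_min ?_ (rpow_half_le_iff.2 hn)
    rw [hs]
    gcongr
    exact ENNReal.sum_le_tsum _

/-! ### Domination by predictable controls -/

theorem IsControl.measurableSet_le {lam : ℕ → Ω → ℝ} (hl : IsControl ℱ lam) (t : ℝ) (i : ℕ) :
    MeasurableSet[ℱ (i - 1)] {ω | lam (i - 1) ω ≤ t} :=
  hl.adapted (i - 1) measurableSet_Iic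

theorem ofReal_le_controlLim (lam : ℕ → Ω → ℝ) (n : ℕ) (ω : Ω) :
    ENNReal.ofReal (lam n ω) ≤ controlLim lam ω := le_iSup (fun n => ENNReal.ofReal (lam n ω)) n

theorem IsControl.measurable_controlLim {lam : ℕ → Ω → ℝ} (hl : IsControl ℱ lam) :
    Measurable (controlLim lam) :=
  Measurable.iSup fun n => ((hl.adapted n).mono (ℱ.le n) le_rfl).ennreal_ofReal

theorem iUnion_compl_subset_lt_controlLim (lam : ℕ → Ω → ℝ) {t : ℝ} (ht : 0 < t) :
    ⋃ i, {ω | lam (i - 1) ω ≤ t}ᶜ ⊆ {ω | ENNReal.ofReal t < controlLim lam ω} := by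
  intro ω hω
  obtain ⟨n, hn⟩ := mem_iUnion.1 hω
  have hn : t < lam (n - 1) ω := not_le.1 hn
  exact ((ENNReal.ofReal_lt_ofReal_iff_of_nonneg ht.le).2 hn).trans_le
    (ofReal_le_controlLim _ _ _)

theorem ControlsSq.dominated [IsFiniteMeasure P] (hf : Martingale f ℱ P) {lam : ℕ → Ω → ℝ}
    (hl : ControlsSq ℱ P f lam) : Dominated P (maxFn f) (controlLim lam) ∧
      Dominated P (sqFn f) (controlLim lam) ∧
      Dominated P (condSqFn ℱ P f) (controlLim lam) := by
  refine dominated_of_transform hf (V := fun t i => {ω | lam (i - 1) ω ≤ t})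
    hl.1.measurableSet_le (fun t ht => iUnion_compl_subset_lt_controlLim lam ht) fun t ht => ?_
  simp only [enorm_tdiff_sq]
  refine tsum_lintegral_indicator_le (fun i => ℱ.le _ _ (hl.1.measurableSet_le t i))
    (fun i => (measurable_enorm_mdiff_sq hf.1 i).mono (ℱ.le i) le_rfl) ?_
  filter_upwards [ae_all_iff.2 hl.2] with ω hω n hn
  rw [← rpow_half_le_iff]
  exact (hω n).trans (le_min (ofReal_le_controlLim _ _ _) (ENNReal.ofReal_le_ofReal hn))

theorem ControlsAbs.dominated [IsFiniteMeasure P] (hf : Martingale f ℱ P) {lam : ℕ → Ω → ℝ}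
    (hl : ControlsAbs ℱ P f lam) : Dominated P (maxFn f) (controlLim lam) ∧
      Dominated P (sqFn f) (controlLim lam) ∧
      Dominated P (condSqFn ℱ P f) (controlLim lam) := by
  refine dominated_of_transform hf (V := fun t i => {ω | lam (i - 1) ω ≤ t})
    hl.1.measurableSet_le (fun t ht => iUnion_compl_subset_lt_controlLim lam ht) fun t ht => ?_
  set V : ℕ → Set Ω := fun i => {ω | lam (i - 1) ω ≤ t} with hVdef
  have hV : ∀ i, MeasurableSet[ℱ (i - 1)] (V i) := hl.1.measurableSet_le t
  have hbd : ∀ᵐ ω ∂P, ∀ n, ‖transform f V n ω‖ₑ ≤ min (controlLim lam ω) (ENNReal.ofReal t) := by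
    filter_upwards [ae_all_iff.2 hl.2] with ω hω n
    have hmem : ∀ n, ω ∈ V n →
        ‖transform f V n ω‖ₑ ≤ min (controlLim lam ω) (ENNReal.ofReal t) := fun n hn => by
      have hmem : ∀ i ≤ n, ω ∈ V i := fun i hi =>
        (hl.1.mono ω (Nat.sub_le_sub_right hi 1)).trans hn
      rw [transform_eq hmem,
        ← ofReal_norm, Real.norm_eq_abs]
      exact (ENNReal.ofReal_le_ofReal (hω n)).trans
        (le_min (ofReal_le_controlLim _ _ _) (ENNReal.ofReal_le_ofReal hn))
    induction n with
    | zero =>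
      by_cases h0 : ω ∈ V 0
      · exact hmem 0 h0
      · simp [transform, tdiff, h0]
    | succ n ih =>
      by_cases hn : ω ∈ V (n + 1)
      · exact hmem _ hn
      · rwa [transform_succ, Pi.add_apply, tdiff, indicator_of_notMem hn, add_zero]
  have hLp : ∀ n, MemLp (transform f V n) 2 P := fun n => by
    refine MemLp.of_bound
      ((stronglyAdapted_transform hf.1 hV n).mono (ℱ.le n)).aestronglyMeasurable t ?_
    filter_upwards [hbd] with ω hω
    have := (hω n).trans (min_le_right _ _)
    rwa [← ofReal_norm, ENNReal.ofReal_le_ofReal_iff ht.le] at this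
  have hL : ∀ i, MemLp (tdiff f V i) 2 P := fun i => by
    cases i with
    | zero =>
      have : tdiff f V 0 = transform f V 0 := by ext ω; simp [transform]
      rw [this]
      exact hLp 0
    | succ n =>
      rw [← add_sub_cancel_left (transform f V n) (tdiff f V (n + 1)), ← transform_succ]
      exact (hLp _).sub (hLp _)
  refine ENNReal.tsum_le_of_sum_range_le fun n => ?_
  refine (Finset.sum_le_sum_of_subset (Finset.range_subset_range.2 n.le_succ)).trans ?_
  rw [← lintegral_transform_sq hf hV hL]
  refine lintegral_mono_ae ?_
  filter_upwards [hbd] with ω hω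
  gcongr
  exact hω n

/-! ### Exchanging the two kinds of controls -/

theorem measurable_partialSups {E : Type*} [SemilatticeSup E] [MeasurableSpace E]
    [MeasurableSup₂ E] {u : ℕ → Ω → E} (hu : ∀ n, Measurable[ℱ n] (u n)) (n : ℕ) :
    Measurable[ℱ n] fun ω => partialSups (fun i => u i ω) n := by
  induction n with
  | zero => simpa using hu 0
  | succ n ih =>
    simp only [← Nat.succ_eq_add_one, ← Nat.succ_eq_succ, partialSups_succ]
    exact Measurable.sup (ih.mono (ℱ.mono n.le_succ) le_rfl) (hu (n + 1))

theorem partialSq_succ_le (f : ℕ → Ω → ℝ) (n : ℕ) (ω : Ω) :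
    partialSq f (n + 1) ω ≤ partialSq f n ω + ‖mdiff f (n + 1) ω‖ₑ := by
  rw [partialSq, rpow_half_le_iff, Finset.sum_range_succ, add_sq']
  have h : ∑ i ∈ Finset.range (n + 1), ‖mdiff f i ω‖ₑ ^ 2 = partialSq f n ω ^ 2 := by
    rw [partialSq, ← ENNReal.rpow_two, ← ENNReal.rpow_mul]
    norm_num
  rw [h]
  exact le_self_add

theorem enorm_mdiff_le_partialSq (f : ℕ → Ω → ℝ) (n : ℕ) (ω : Ω) :
    ‖mdiff f n ω‖ₑ ≤ partialSq f n ω := by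
  rw [partialSq, one_div, ENNReal.le_rpow_inv_iff two_pos, ENNReal.rpow_two]
  exact Finset.single_le_sum (f := fun i => ‖mdiff f i ω‖ₑ ^ 2) (fun i _ => zero_le)
    (Finset.self_mem_range_succ n)

theorem partialSq_mono (f : ℕ → Ω → ℝ) (ω : Ω) : Monotone fun n => partialSq f n ω := by
  intro a b hab
  simp only [partialSq]
  gcongr

theorem partialSq_lt_top (f : ℕ → Ω → ℝ) (n : ℕ) (ω : Ω) : partialSq f n ω < ∞ :=
  ENNReal.rpow_lt_top_of_nonneg (by norm_num)
    (ENNReal.sum_lt_top.2 fun i _ => by simp).ne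

theorem partialSq_le_sqFn (f : ℕ → Ω → ℝ) (n : ℕ) (ω : Ω) : partialSq f n ω ≤ sqFn f ω := by
  rw [partialSq, sqFn]
  gcongr
  exact ENNReal.sum_le_tsum _

theorem measurable_partialSq (hf : StronglyAdapted ℱ f) (n : ℕ) :
    Measurable[ℱ n] (partialSq f n) := by
  refine Measurable.pow_const (Finset.measurable_fun_sum _ fun i hi => ?_) _
  exact (measurable_enorm_mdiff_sq hf i).mono (ℱ.mono (Finset.mem_range_succ_iff.1 hi)) le_rfl

/-- A control of `S_n(f)` yields the control `max_{i ≤ n} |f_i| + λ_n` of `|f_n|`. -/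
theorem ControlsSq.exists_controlsAbs (hf : StronglyAdapted ℱ f) {lam : ℕ → Ω → ℝ}
    (hl : ControlsSq ℱ P f lam) : ∃ lam' : ℕ → Ω → ℝ, ControlsAbs ℱ P f lam' ∧
      ∀ ω, controlLim lam' ω ≤ maxFn f ω + 2 * controlLim lam ω := by
  have hps : ∀ n ω, |f n ω| ≤ partialSups (fun i => |f i ω|) n := fun n ω =>
    le_partialSups (fun i => |f i ω|) n
  refine ⟨fun n ω => partialSups (fun i => |f i ω|) n + lam n ω, ⟨⟨fun n ω => ?_, fun ω => ?_,
    fun n => ?_⟩, fun n => ?_⟩, fun ω => iSup_le fun n => ?_⟩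
  · exact add_nonneg ((abs_nonneg _).trans (hps n ω)) (hl.1.nonneg n ω)
  · exact (partialSups fun i => |f i ω|).monotone.add (hl.1.mono ω)
  · have hm : Measurable[ℱ n] fun ω => partialSups (fun i => |f i ω|) n :=
      measurable_partialSups (fun n => (hf n).norm.measurable) n
    exact hm.add (hl.1.adapted n)
  · filter_upwards [hl.2 n] with ω hω
    have hd : |mdiff f n ω| ≤ lam (n - 1) ω := by
      have := (enorm_mdiff_le_partialSq f n ω).trans hω
      rwa [← ofReal_norm, ENNReal.ofReal_le_ofReal_iff (hl.1.nonneg _ _)] at this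
    cases n with
    | zero => exact hd.trans (le_add_of_nonneg_left ((abs_nonneg _).trans (hps 0 ω)))
    | succ n =>
      have e : f (n + 1) ω = f n ω + mdiff f (n + 1) ω := by simp [mdiff]
      rw [e]
      exact (abs_add_le _ _).trans (add_le_add (hps n ω) hd)
  · rw [two_mul, ← add_assoc]
    refine ENNReal.ofReal_add_le.trans ((add_le_add ?_ (ofReal_le_controlLim lam n ω)).trans
      le_self_add)
    by_cases hM : maxFn f ω = ∞
    · rw [hM]; exact le_top
    rw [ENNReal.ofReal_le_iff_le_toReal hM]
    refine partialSups_le _ _ _ fun i _ => ?_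
    rw [← ENNReal.ofReal_le_iff_le_toReal hM, ← Real.norm_eq_abs, ofReal_norm]
    exact le_iSup (fun i => ‖f i ω‖ₑ) i

/-- A control of `|f_n|` yields the control `S_n(f) + 2 λ_n` of `S_n(f)`. -/
theorem ControlsAbs.exists_controlsSq (hf : StronglyAdapted ℱ f) {lam : ℕ → Ω → ℝ}
    (hl : ControlsAbs ℱ P f lam) : ∃ lam' : ℕ → Ω → ℝ, ControlsSq ℱ P f lam' ∧
      ∀ ω, controlLim lam' ω ≤ sqFn f ω + 2 * controlLim lam ω := by
  have hS : ∀ n ω, ENNReal.ofReal ((partialSq f n ω).toReal + 2 * lam n ω) =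
      partialSq f n ω + 2 * ENNReal.ofReal (lam n ω) := fun n ω => by
    rw [ENNReal.ofReal_add ENNReal.toReal_nonneg (by linarith [hl.1.nonneg n ω]),
      ENNReal.ofReal_toReal (partialSq_lt_top f n ω).ne, ENNReal.ofReal_mul two_pos.le]
    simp
  refine ⟨fun n ω => (partialSq f n ω).toReal + 2 * lam n ω, ⟨⟨fun n ω => ?_, fun ω => ?_,
    fun n => ?_⟩, fun n => ?_⟩, fun ω => iSup_le fun n => ?_⟩
  · linarith [hl.1.nonneg n ω, (partialSq f n ω).toReal_nonneg]
  · intro a b hab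
    have h1 := ENNReal.toReal_mono (partialSq_lt_top f b ω).ne (partialSq_mono f ω hab)
    have h2 := hl.1.mono ω hab
    dsimp only at h1 h2 ⊢
    linarith
  · exact (measurable_partialSq hf n).ennreal_toReal.add ((hl.1.adapted n).const_mul 2)
  · cases n with
    | zero =>
      refine ae_of_all _ fun ω => ?_
      rw [hS]
      exact le_self_add
    | succ n =>
      filter_upwards [hl.2 n, hl.2 (n + 1)] with ω h1 h2
      rw [hS]
      refine (partialSq_succ_le f n ω).trans (add_le_add le_rfl ?_)
      have h3 : |f n ω| ≤ lam n ω := h1.trans (hl.1.mono ω (Nat.sub_le n 1))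
      have h4 : |f (n + 1) ω - f n ω| ≤ 2 * lam n ω := by
        have h2 : |f (n + 1) ω| ≤ lam n ω := h2
        linarith [abs_sub (f (n + 1) ω) (f n ω)]
      have := ENNReal.ofReal_le_ofReal h4
      rw [ENNReal.ofReal_mul two_pos.le, ENNReal.ofReal_ofNat, ← Real.norm_eq_abs,
        ofReal_norm] at this
      exact this
  · rw [hS]
    gcongr
    · exact partialSq_le_sqFn f n ω
    · exact ofReal_le_controlLim lam n ω

theorem measure_three_mul_lt_le {h g₁ g₂ : Ω → ℝ≥0∞} (hh : ∀ ω, h ω ≤ g₁ ω + 2 * g₂ ω) (t : ℝ) :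
    P {ω | ENNReal.ofReal (3 * t) < h ω} ≤
      P {ω | ENNReal.ofReal t < g₁ ω} + P {ω | ENNReal.ofReal t < g₂ ω} := by
  refine (measure_mono fun ω hω => ?_).trans (measure_union_le _ _)
  by_contra hc
  simp only [mem_union, mem_ofPred_eq, not_or, not_lt] at hc
  refine absurd hω (not_lt.2 ((hh ω).trans ((add_le_add hc.1 (mul_le_mul_right hc.2 2)).trans ?_)))
  rw [ENNReal.ofReal_mul (by norm_num), ENNReal.ofReal_ofNat]
  exact le_of_eq (by ring)

end

/-! ### Predictable majorants on a regular basis -/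

section

variable {Ω : Type u} {m0 : MeasurableSpace Ω} {P : Measure Ω} {ℱ : Filtration ℕ m0}

/-- On a regular basis an adapted increasing process `X` has a predictable dyadic majorant: where
`X` first exceeds `2 ^ k` at time `n`, an event of `ℱ n`, regularity provides a slightly larger
event of `ℱ (n - 1)`, so that the crossing can be announced one step ahead. -/
theorem IsRegular.exists_predictable_majorant {R : ℝ≥0} (hreg : IsRegular ℱ P R)
    {X : ℕ → Ω → ℝ≥0∞} (hX : ∀ n, Measurable[ℱ n] (X n)) :
    ∃ Y : ℕ → Ω → ℝ≥0∞, (∀ n, Measurable[ℱ n] (Y n)) ∧ (∀ ω, Monotone fun n => Y n ω) ∧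
      (∀ n ω, X n ω ≤ Y (n - 1) ω) ∧
      ∀ (k : ℤ) (t : ℝ), (2 : ℝ) ^ k ≤ t → P {ω | ENNReal.ofReal t < ⨆ n, Y n ω} ≤
        ∑' j : ℕ, R * P {ω | ENNReal.ofReal (2 ^ (k + j)) < ⨆ n, X n ω} := by
  set q : ℤ → ℝ≥0∞ := fun k => ENNReal.ofReal (2 ^ k) with hq
  -- `A k n` is the event that `X` exceeds `2 ^ k` for the first time at `n`.
  set A : ℤ → ℕ → Set Ω := fun k n => {ω | q k < X n ω} ∩ ⋂ i : Fin n, {ω | q k < X i ω}ᶜ with hA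
  have hlt : ∀ k n, MeasurableSet[ℱ n] {ω | q k < X n ω} := fun k n => hX n measurableSet_Ioi
  have hAm : ∀ k n, MeasurableSet[ℱ n] (A k n) := fun k n =>
    (hlt k n).inter (MeasurableSet.iInter fun i => (ℱ.mono i.2.le _ (hlt k i)).compl)
  choose B hBm hAB hBP using fun k n => hreg n (A k n) (hAm k n)
  set D : ℤ → ℕ → Set Ω := fun k n => ⋃ m : Fin (n + 2), B k m with hD
  have hDm : ∀ k n, MeasurableSet[ℱ n] (D k n) := fun k n =>
    MeasurableSet.iUnion fun m => ℱ.mono (by omega) _ (hBm k m)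
  have hDU : ∀ k n, D k n ⊆ ⋃ m, B k m := fun k n => iUnion_subset fun m =>
    subset_iUnion (B k) (m : ℕ)
  have hcross : ∀ k n ω, q k < X n ω → ∃ m ≤ n, ω ∈ A k m := by
    classical
    intro k n ω h
    have hex : ∃ n, q k < X n ω := ⟨n, h⟩
    refine ⟨Nat.find hex, Nat.find_min' hex h, Nat.find_spec hex, mem_iInter.2 fun i => ?_⟩
    exact Nat.find_min hex i.2
  have hPB : ∀ k, P (⋃ m, B k m) ≤ R * P {ω | q k < ⨆ n, X n ω} := fun k => by
    have hdisj : Pairwise (Function.onFun Disjoint (A k)) := by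
      refine (symm_disjoint.pairwise_on (A k)).2 fun m n hmn => ?_
      refine disjoint_left.2 fun ω hm hn => ?_
      exact (mem_iInter.1 hn.2 ⟨m, hmn⟩) hm.1
    calc P (⋃ m, B k m) ≤ ∑' m, P (B k m) := measure_iUnion_le _
      _ ≤ ∑' m, R * P (A k m) := ENNReal.tsum_le_tsum fun m => hBP k m
      _ = R * P (⋃ m, A k m) := by
        rw [ENNReal.tsum_mul_left, measure_iUnion hdisj fun m => ℱ.le _ _ (hAm k m)]
      _ ≤ _ := by
        gcongr
        refine iUnion_subset fun m ω hω => ?_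
        exact lt_of_lt_of_le hω.1 (le_iSup (fun n => X n ω) m)
  refine ⟨fun n ω => ⨆ k, (D k n).indicator (fun _ => q (k + 1)) ω, fun n => ?_, fun ω => ?_,
    fun n ω => ?_, fun k t hkt => ?_⟩
  · exact Measurable.iSup fun k => measurable_const.indicator (hDm k n)
  · intro a b hab
    refine iSup_mono fun k => indicator_le_indicator_of_subset ?_ (fun _ => zero_le) ω
    exact iUnion_subset fun m => subset_iUnion (fun m : Fin (b + 2) => B k m) ⟨m, by omega⟩
  · refine ENNReal.le_of_forall_nnreal_lt fun r hr => ?_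
    rcases eq_or_ne r 0 with rfl | hr0
    · simp
    obtain ⟨k, hk1, hk2⟩ := exists_mem_Ico_zpow (x := (r : ℝ)) (y := 2)
      (by exact_mod_cast pos_iff_ne_zero.2 hr0) one_lt_two
    have hqr : q k ≤ r := by
      rw [← ENNReal.ofReal_coe_nnreal]; exact ENNReal.ofReal_le_ofReal hk1
    obtain ⟨m, hmn, hm⟩ := hcross k n ω (hqr.trans_lt hr)
    have hmD : ω ∈ D k (n - 1) := mem_iUnion.2 ⟨⟨m, by omega⟩, hAB k m hm⟩
    refine le_trans ?_ (le_iSup (fun k => (D k (n - 1)).indicator (fun _ => q (k + 1)) ω) k)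
    rw [indicator_of_mem hmD, ← ENNReal.ofReal_coe_nnreal]
    exact ENNReal.ofReal_le_ofReal hk2.le
  · refine (measure_mono (t := ⋃ j : ℕ, ⋃ m, B (k + j) m) fun ω hω => ?_).trans
      ((measure_iUnion_le _).trans (ENNReal.tsum_le_tsum fun j => hPB _))
    rw [mem_ofPred_eq, lt_iSup_iff] at hω
    obtain ⟨n, hn⟩ := hω
    obtain ⟨i, hi⟩ := lt_iSup_iff.1 hn
    by_cases hiD : ω ∈ D i n
    · rw [indicator_of_mem hiD] at hi
      have h1 : (2 : ℝ) ^ k < 2 ^ (i + 1) :=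
        hkt.trans_lt (ENNReal.ofReal_lt_ofReal_iff'.1 hi).1
      have h2 : k < i + 1 := (zpow_lt_zpow_iff_right₀ one_lt_two).1 h1
      obtain ⟨j, hj⟩ := Int.eq_ofNat_of_zero_le (show 0 ≤ i - k by omega)
      refine mem_iUnion.2 ⟨j, ?_⟩
      rw [← hj, add_sub_cancel]
      exact hDU i n hiD
    · rw [indicator_of_notMem hiD] at hi
      exact absurd hi not_lt_zero

/-- The lower type of `Φ` makes the dyadic tails of a weak-type bound summable. -/
theorem MemG.exists_tsum_le {ℓ : ℝ} (hℓ : 0 < ℓ) (hℓ1 : ℓ ≤ 1) {Φ : ℝ → ℝ} (hΦ : MemG ℓ Φ)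
    (hconc : ConcaveOn ℝ (Ici 0) Φ) (R : ℝ≥0) : ∃ N : ℝ, 1 ≤ N ∧ ∀ (p : ℝ → ℝ≥0∞) (c : ℝ), 0 < c →
      (∀ t : ℝ, 0 < t → ENNReal.ofReal (Φ (t / c)) * p t ≤ 1) →
      ∀ (k : ℤ) (t : ℝ), (2 : ℝ) ^ k ≤ t → t < 2 ^ (k + 1) →
        ENNReal.ofReal (Φ (t / c)) * ∑' j : ℕ, R * p (2 ^ (k + j)) ≤ ENNReal.ofReal N := by
  obtain ⟨a, ha1, ha⟩ := hΦ.type_le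
  set ρ : ℝ := (2 : ℝ)⁻¹ ^ ℓ with hρ
  have hρ0 : 0 ≤ ρ := by positivity
  have hρ1 : ρ < 1 := Real.rpow_lt_one (by norm_num) (by norm_num) hℓ
  have hterm : ∀ j : ℕ, 0 ≤ R * (2 * a * ρ ^ j) := fun j => by positivity
  have hsum : Summable fun j : ℕ => R * (2 * a * ρ ^ j) :=
    ((summable_geometric_of_lt_one hρ0 hρ1).mul_left _).mul_left _
  refine ⟨max 1 (∑' j : ℕ, R * (2 * a * ρ ^ j)), le_max_left _ _,
    fun p c hc hp k t hkt htk => ?_⟩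
  have h2k : (0 : ℝ) < 2 ^ k := by positivity
  have hcomp : ∀ j : ℕ, Φ (t / c) ≤ 2 * a * ρ ^ j * Φ (2 ^ (k + j) / c) := fun j => by
    have hpos : 0 ≤ Φ (2 ^ k / c) := hΦ.nonneg _ (by positivity)
    have h1 : Φ (t / c) ≤ t / 2 ^ k * Φ (2 ^ k / c) := by
      have := map_mul_le_mul_map_of_concaveOn hconc hΦ.map_zero (a := t / 2 ^ k) (r := 2 ^ k / c)
        ((one_le_div h2k).2 hkt) (by positivity)
      rwa [show t / 2 ^ k * (2 ^ k / c) = t / c by field_simp] at this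
    have h2 : t / 2 ^ k ≤ 2 := by
      rw [div_le_iff₀ h2k, ← zpow_one_add₀ two_ne_zero, add_comm]
      exact htk.le
    have h3 := ha ((2 : ℝ)⁻¹ ^ j) (2 ^ (k + j) / c) (by positivity) (by positivity)
    have h4 : max (((2 : ℝ)⁻¹ ^ j) ^ ℓ) ((2 : ℝ)⁻¹ ^ j) = ρ ^ j := by
      have e : ((2 : ℝ)⁻¹ ^ j) ^ ℓ = ρ ^ j := by
        rw [hρ, ← Real.rpow_natCast, ← Real.rpow_mul (by norm_num), mul_comm, Real.rpow_mul
          (by norm_num), Real.rpow_natCast]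
      rw [max_eq_left, e]
      rw [e]
      refine pow_le_pow_left₀ (by norm_num) ?_ j
      conv_lhs => rw [← Real.rpow_one (2 : ℝ)⁻¹]
      exact Real.rpow_le_rpow_of_exponent_ge (by norm_num) (by norm_num) hℓ1
    rw [h4, show (2 : ℝ)⁻¹ ^ j * (2 ^ (k + j) / c) = 2 ^ k / c by
      rw [zpow_add₀ two_ne_zero, zpow_natCast, inv_pow]; field_simp] at h3
    calc Φ (t / c) ≤ t / 2 ^ k * Φ (2 ^ k / c) := h1
      _ ≤ 2 * Φ (2 ^ k / c) := by gcongr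
      _ ≤ 2 * (a * ρ ^ j * Φ (2 ^ (k + j) / c)) := by gcongr
      _ = _ := by ring
  rw [← ENNReal.tsum_mul_left]
  refine le_trans ?_ (ENNReal.ofReal_le_ofReal (le_max_right _ _))
  rw [ENNReal.ofReal_tsum_of_nonneg hterm hsum]
  refine ENNReal.tsum_le_tsum fun j => ?_
  have hnn : 0 ≤ 2 * a * ρ ^ j := by positivity
  calc ENNReal.ofReal (Φ (t / c)) * (R * p (2 ^ (k + j)))
      ≤ ENNReal.ofReal (2 * a * ρ ^ j * Φ (2 ^ (k + j) / c)) * (R * p (2 ^ (k + j))) := by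
        gcongr; exact hcomp j
    _ = R * ENNReal.ofReal (2 * a * ρ ^ j) *
        (ENNReal.ofReal (Φ (2 ^ (k + j) / c)) * p (2 ^ (k + j))) := by
        rw [ENNReal.ofReal_mul hnn]; ring
    _ ≤ R * ENNReal.ofReal (2 * a * ρ ^ j) * 1 := by
        gcongr; exact hp _ (by positivity)
    _ = ENNReal.ofReal (R * (2 * a * ρ ^ j)) := by
        rw [mul_one, ENNReal.ofReal_mul R.coe_nonneg, ENNReal.ofReal_coe_nnreal]

/-- A function with a weak-type bound is finite almost everywhere. -/
theorem MemG.ae_ne_top [IsFiniteMeasure P] {ℓ : ℝ} {Φ : ℝ → ℝ} (hΦ : MemG ℓ Φ) {g : Ω → ℝ≥0∞}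
    {c : ℝ} (hc : 0 < c) {N : ℝ} (hb : ∀ t : ℝ, 0 < t → ENNReal.ofReal (Φ (t / c)) *
      P {ω | ENNReal.ofReal t < g ω} ≤ ENNReal.ofReal N) : ∀ᵐ ω ∂P, g ω ≠ ∞ := by
  rw [ae_iff]
  simp only [not_not]
  by_contra h0
  set p := P {ω | g ω = ∞} with hp
  have hp0 : 0 < p.toReal := ENNReal.toReal_pos h0 (measure_ne_top _ _)
  obtain ⟨x, hx0, hx⟩ := ((eventually_gt_atTop (0 : ℝ)).and
    (hΦ.tendsto_atTop.eventually_gt_atTop (max N 0 / p.toReal))).exists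
  have h := hb (x * c) (by positivity)
  rw [mul_div_cancel_right₀ _ hc.ne'] at h
  have h1 : ENNReal.ofReal (Φ x) * p ≤ ENNReal.ofReal N := by
    refine le_trans ?_ h
    gcongr
    rw [hp]
    refine measure_mono fun ω (hω : g ω = ∞) => ?_
    rw [mem_ofPred_eq, hω]
    exact ENNReal.ofReal_lt_top
  rw [← ENNReal.ofReal_toReal (show p ≠ ∞ from measure_ne_top _ _),
    ← ENNReal.ofReal_mul (hΦ.nonneg x hx0.le)] at h1
  have h2 : max N 0 < Φ x * p.toReal := (div_lt_iff₀ hp0).1 hx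
  have h3 : ENNReal.ofReal N < ENNReal.ofReal (Φ x * p.toReal) :=
    (ENNReal.ofReal_lt_ofReal_iff ((le_max_right N 0).trans_lt h2)).2
      ((le_max_left N 0).trans_lt h2)
  exact absurd h1 (not_le.2 h3)

/-- On a regular basis, an adapted process with a weak-type bound has a control with a comparable
weak-type bound. -/
theorem IsRegular.exists_isControl {ℓ : ℝ} (hℓ : 0 < ℓ) (hℓ1 : ℓ ≤ 1) {Φ : ℝ → ℝ}
    (hΦ : MemG ℓ Φ) (hconc : ConcaveOn ℝ (Ici 0) Φ) (R : ℝ≥0) :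
    ∃ N : ℝ, 1 ≤ N ∧ ∀ (Ω : Type u) (m0 : MeasurableSpace Ω) (P : Measure Ω)
      (_ : IsProbabilityMeasure P) (ℱ : Filtration ℕ m0), IsRegular ℱ P R →
      ∀ X : ℕ → Ω → ℝ≥0∞, (∀ n, Measurable[ℱ n] (X n)) → ∀ c : ℝ, 0 < c →
      (∀ t : ℝ, 0 < t → ENNReal.ofReal (Φ (t / c)) *
        P {ω | ENNReal.ofReal t < ⨆ n, X n ω} ≤ 1) →
      ∃ lam : ℕ → Ω → ℝ, IsControl ℱ lam ∧
        (∀ n, ∀ᵐ ω ∂P, X n ω ≤ ENNReal.ofReal (lam (n - 1) ω)) ∧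
        ∀ t : ℝ, 0 < t → ENNReal.ofReal (Φ (t / c)) *
          P {ω | ENNReal.ofReal t < controlLim lam ω} ≤ ENNReal.ofReal N := by
  obtain ⟨N, hN1, hN⟩ := hΦ.exists_tsum_le hℓ hℓ1 hconc R
  refine ⟨N, hN1, fun Ω m0 P _ ℱ hreg X hX c hc hb => ?_⟩
  obtain ⟨Y, hYm, hYmono, hXY, hYP⟩ := hreg.exists_predictable_majorant hX
  have hYb : ∀ t : ℝ, 0 < t → ENNReal.ofReal (Φ (t / c)) *
      P {ω | ENNReal.ofReal t < ⨆ n, Y n ω} ≤ ENNReal.ofReal N := fun t ht => by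
    obtain ⟨k, hk1, hk2⟩ := exists_mem_Ico_zpow ht (one_lt_two (α := ℝ))
    exact (mul_le_mul_right (hYP k t hk1) _).trans
      (hN (fun s => P {ω | ENNReal.ofReal s < ⨆ n, X n ω}) c hc hb k t hk1 hk2)
  -- `Y` may be infinite on a null set; the running maximum keeps its real version monotone there.
  set lam : ℕ → Ω → ℝ := fun n ω => partialSups (fun i => (Y i ω).toReal) n with hlam
  have hle : ∀ n ω, (Y n ω).toReal ≤ lam n ω := fun n ω =>
    le_partialSups (fun i => (Y i ω).toReal) n
  have hlamY : ∀ n ω, ENNReal.ofReal (lam n ω) ≤ Y n ω := fun n ω => by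
    by_cases hY : Y n ω = ∞
    · rw [hY]; exact le_top
    rw [ENNReal.ofReal_le_iff_le_toReal hY]
    exact partialSups_le _ _ _ fun i hi => ENNReal.toReal_mono hY (hYmono ω hi)
  refine ⟨lam, ⟨fun n ω => ENNReal.toReal_nonneg.trans (hle n ω),
    fun ω => (partialSups fun i => (Y i ω).toReal).monotone,
    fun n => measurable_partialSups (fun n => (hYm n).ennreal_toReal) n⟩, fun n => ?_,
    fun t ht => ?_⟩
  · filter_upwards [hΦ.ae_ne_top hc hYb] with ω hω
    refine (hXY n ω).trans ?_
    rw [ENNReal.le_ofReal_iff_toReal_le (ne_top_of_le_ne_top hω (le_iSup (fun n => Y n ω) _))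
      (ENNReal.toReal_nonneg.trans (hle _ ω))]
    exact hle _ ω
  · refine le_trans ?_ (hYb t ht)
    gcongr
    exact iSup_mono fun n => hlamY n _

end

/-! ### Comparison of the quasi-norms -/

section

variable {Ω : Type u} {m0 : MeasurableSpace Ω} {P : Measure Ω} {ℱ : Filtration ℕ m0}
  {f : ℕ → Ω → ℝ}

theorem measurable_condSqFn : Measurable (condSqFn ℱ P f) :=
  (Measurable.tsum fun _ => measurable_condLExp' _ _ _).pow_const _

theorem le_mul_normQ {Φ : ℝ → ℝ} {C : ℝ≥0} (hC : 0 < C) {x : ℝ≥0∞}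
    (h : ∀ lam, ControlsSq ℱ P f lam → x ≤ C * wnorm Φ P (controlLim lam)) :
    x ≤ C * normQ Φ ℱ P f := by
  have hC0 : (C : ℝ≥0∞) ≠ 0 := by simpa using hC.ne'
  rw [mul_comm, ← ENNReal.div_le_iff hC0 ENNReal.coe_ne_top]
  refine le_iInf₂ fun lam hl => ?_
  rw [ENNReal.div_le_iff hC0 ENNReal.coe_ne_top, mul_comm]
  exact h lam hl

theorem le_mul_normD {Φ : ℝ → ℝ} {C : ℝ≥0} (hC : 0 < C) {x : ℝ≥0∞}
    (h : ∀ lam, ControlsAbs ℱ P f lam → x ≤ C * wnorm Φ P (controlLim lam)) :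
    x ≤ C * normD Φ ℱ P f := by
  have hC0 : (C : ℝ≥0∞) ≠ 0 := by simpa using hC.ne'
  rw [mul_comm, ← ENNReal.div_le_iff hC0 ENNReal.coe_ne_top]
  refine le_iInf₂ fun lam hl => ?_
  rw [ENNReal.div_le_iff hC0 ENNReal.coe_ne_top, mul_comm]
  exact h lam hl

theorem mem_spaceQ_iff {Φ : ℝ → ℝ} :
    f ∈ spaceQ Φ ℱ P ↔ Martingale f ℱ P ∧ normQ Φ ℱ P f < ∞ := by
  simp [spaceQ, normQ, iInf_lt_iff]

theorem mem_spaceD_iff {Φ : ℝ → ℝ} :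
    f ∈ spaceD Φ ℱ P ↔ Martingale f ℱ P ∧ normD Φ ℱ P f < ∞ := by
  simp [spaceD, normD, iInf_lt_iff]

end

/-- A function dominated by `g₂`, even after adding `2 g₂`, has quasi-norm at most a multiple of that
of `g₂`. The extra term serves the passage between the two kinds of controls. -/
theorem MemG.exists_wnorm_le_of_dominated {ℓ : ℝ} (hℓ : 0 < ℓ) (hℓ1 : ℓ ≤ 1) {Φ : ℝ → ℝ}
    (hΦ : MemG ℓ Φ) (hconc : ConcaveOn ℝ (Ici 0) Φ) :
    ∃ C : ℝ≥0, 0 < C ∧ ∀ (Ω : Type u) (_ : MeasurableSpace Ω) (P : Measure Ω)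
      (h g₁ g₂ : Ω → ℝ≥0∞), Dominated P g₁ g₂ → Measurable g₂ →
      (∀ ω, h ω ≤ g₁ ω + 2 * g₂ ω) → wnorm Φ P h ≤ C * wnorm Φ P g₂ := by
  obtain ⟨C, hC, hCb⟩ := hΦ.exists_wnorm_le.{u} hℓ hℓ1 (K := 3) (N := 4)
    (by norm_num) (by norm_num)
  refine ⟨C, hC, fun Ω m0 P h g₁ g₂ hd hg hh => le_mul_wnorm hC fun c hc hb => ?_⟩
  refine hCb Ω m0 P h c hc fun t ht => ?_
  calc _ ≤ ENNReal.ofReal (Φ (t / c)) *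
        (P {ω | ENNReal.ofReal t < g₁ ω} + P {ω | ENNReal.ofReal t < g₂ ω}) := by
        gcongr; exact measure_three_mul_lt_le hh t
    _ ≤ 3 + 1 := by
        rw [mul_add]
        exact add_le_add
          (hd.mul_measure_le hconc hΦ.map_zero hg.aemeasurable hc hb ht) (hb t ht)
    _ = ENNReal.ofReal 4 := by norm_num

/-- The comparisons that hold on every filtered probability space. -/
theorem MemG.exists_norm_comparison {ℓ : ℝ} (hℓ : 0 < ℓ) (hℓ1 : ℓ ≤ 1) {Φ : ℝ → ℝ}
    (hΦ : MemG ℓ Φ) (hconc : ConcaveOn ℝ (Ici 0) Φ) :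
    ∃ C : ℝ≥0, 0 < C ∧
      ∀ (Ω : Type u) (m0 : MeasurableSpace Ω) (P : Measure Ω) (_ : IsProbabilityMeasure P)
        (ℱ : Filtration ℕ m0) (f : ℕ → Ω → ℝ), Martingale f ℱ P →
        (normH Φ P f ≤ C * normHs Φ ℱ P f ∧ normHS Φ P f ≤ C * normHs Φ ℱ P f) ∧
        (normH Φ P f ≤ C * normQ Φ ℱ P f ∧ normHS Φ P f ≤ C * normQ Φ ℱ P f ∧
          normHs Φ ℱ P f ≤ C * normQ Φ ℱ P f) ∧
        (normH Φ P f ≤ C * normD Φ ℱ P f ∧ normHS Φ P f ≤ C * normD Φ ℱ P f ∧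
          normHs Φ ℱ P f ≤ C * normD Φ ℱ P f) ∧
        (normD Φ ℱ P f ≤ C * normQ Φ ℱ P f ∧ normQ Φ ℱ P f ≤ C * normD Φ ℱ P f) := by
  obtain ⟨C, hC, hadd⟩ := hΦ.exists_wnorm_le_of_dominated.{u} hℓ hℓ1 hconc
  refine ⟨C, hC, fun Ω m0 P _ ℱ f hf => ?_⟩
  have hdom : ∀ {h g : Ω → ℝ≥0∞}, Dominated P h g → Measurable g →
      wnorm Φ P h ≤ C * wnorm Φ P g := fun hd hg =>
    hadd Ω m0 P _ _ _ hd hg fun _ => le_self_add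
  have hs := dominated_condSqFn hf
  refine ⟨⟨hdom hs.1 measurable_condSqFn, hdom hs.2 measurable_condSqFn⟩,
    ⟨le_mul_normQ hC fun lam hl => hdom (hl.dominated hf).1 hl.1.measurable_controlLim,
      le_mul_normQ hC fun lam hl => hdom (hl.dominated hf).2.1 hl.1.measurable_controlLim,
      le_mul_normQ hC fun lam hl => hdom (hl.dominated hf).2.2 hl.1.measurable_controlLim⟩,
    ⟨le_mul_normD hC fun lam hl => hdom (hl.dominated hf).1 hl.1.measurable_controlLim,
      le_mul_normD hC fun lam hl => hdom (hl.dominated hf).2.1 hl.1.measurable_controlLim,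
      le_mul_normD hC fun lam hl => hdom (hl.dominated hf).2.2 hl.1.measurable_controlLim⟩,
    le_mul_normQ hC fun lam hl => ?_, le_mul_normD hC fun lam hl => ?_⟩
  · obtain ⟨lam', hl', hle⟩ := hl.exists_controlsAbs hf.1
    exact (iInf₂_le lam' hl').trans
      (hadd Ω m0 P _ _ _ (hl.dominated hf).1 hl.1.measurable_controlLim hle)
  · obtain ⟨lam', hl', hle⟩ := hl.exists_controlsSq hf.1
    exact (iInf₂_le lam' hl').trans
      (hadd Ω m0 P _ _ _ (hl.dominated hf).2.1 hl.1.measurable_controlLim hle)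

/-- The two reverse comparisons on a regular basis, from predictable majorants of the processes
`S_n(f)` and `|f_n|`. -/
theorem IsRegular.exists_norm_comparison {ℓ : ℝ} (hℓ : 0 < ℓ) (hℓ1 : ℓ ≤ 1) {Φ : ℝ → ℝ}
    (hΦ : MemG ℓ Φ) (hconc : ConcaveOn ℝ (Ici 0) Φ) (R : ℝ≥0) :
    ∃ C : ℝ≥0, 0 < C ∧
      ∀ (Ω : Type u) (m0 : MeasurableSpace Ω) (P : Measure Ω) (_ : IsProbabilityMeasure P)
        (ℱ : Filtration ℕ m0), IsRegular ℱ P R → ∀ f : ℕ → Ω → ℝ, StronglyAdapted ℱ f →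
        normQ Φ ℱ P f ≤ C * normHS Φ P f ∧ normD Φ ℱ P f ≤ C * normH Φ P f := by
  obtain ⟨N, hN1, hN⟩ := IsRegular.exists_isControl.{u} hℓ hℓ1 hΦ hconc R
  obtain ⟨C, hC, hCb⟩ := hΦ.exists_wnorm_le.{u} hℓ hℓ1 (K := 1) le_rfl hN1
  simp only [one_mul] at hCb
  refine ⟨C, hC, fun Ω m0 P hP ℱ hreg f hf =>
    ⟨le_mul_wnorm hC fun c hc hb => ?_, le_mul_wnorm hC fun c hc hb => ?_⟩⟩
  · obtain ⟨lam, hl, hle, hlb⟩ := hN Ω m0 P hP ℱ hreg (partialSq f) (measurable_partialSq hf) c hc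
      fun t ht => by
        refine le_trans ?_ (hb t ht)
        gcongr
        exact iSup_le fun n => partialSq_le_sqFn f n _
    exact (iInf₂_le lam ⟨hl, hle⟩).trans (hCb Ω m0 P _ c hc hlb)
  · obtain ⟨lam, hl, hle, hlb⟩ := hN Ω m0 P hP ℱ hreg (fun n ω => ‖f n ω‖ₑ)
      (fun n => (hf n).enorm) c hc hb
    refine (iInf₂_le lam ⟨hl, fun n => ?_⟩).trans (hCb Ω m0 P _ c hc hlb)
    filter_upwards [hle n] with ω hω
    rwa [← ofReal_norm, ENNReal.ofReal_le_ofReal_iff (hl.nonneg _ _)] at hω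

end WeakOrlicz

end

theorem theorem4p3 (ℓ : ℝ) (hℓ : 0 < ℓ) (hℓ1 : ℓ ≤ 1) (Φ : ℝ → ℝ)
    (hΦ : WeakOrlicz.MemG ℓ Φ) (hconc : ConcaveOn ℝ (Ici 0) Φ)
    (hq : WeakOrlicz.upperIndex (WeakOrlicz.inverse Φ) < ∞) :
    (∃ C : ℝ≥0, 0 < C ∧
      ∀ (Ω : Type u) (m0 : MeasurableSpace Ω) (P : Measure Ω) (_ : IsProbabilityMeasure P)
        (ℱ : Filtration ℕ m0) (f : ℕ → Ω → ℝ), Martingale f ℱ P →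
        (WeakOrlicz.normH Φ P f ≤ C * WeakOrlicz.normHs Φ ℱ P f ∧
          WeakOrlicz.normHS Φ P f ≤ C * WeakOrlicz.normHs Φ ℱ P f) ∧
        (WeakOrlicz.normH Φ P f ≤ C * WeakOrlicz.normQ Φ ℱ P f ∧
          WeakOrlicz.normHS Φ P f ≤ C * WeakOrlicz.normQ Φ ℱ P f ∧
          WeakOrlicz.normHs Φ ℱ P f ≤ C * WeakOrlicz.normQ Φ ℱ P f) ∧
        (WeakOrlicz.normH Φ P f ≤ C * WeakOrlicz.normD Φ ℱ P f ∧
          WeakOrlicz.normHS Φ P f ≤ C * WeakOrlicz.normD Φ ℱ P f ∧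
          WeakOrlicz.normHs Φ ℱ P f ≤ C * WeakOrlicz.normD Φ ℱ P f) ∧
        ((C : ℝ≥0∞)⁻¹ * WeakOrlicz.normD Φ ℱ P f ≤ WeakOrlicz.normQ Φ ℱ P f ∧
          WeakOrlicz.normQ Φ ℱ P f ≤ C * WeakOrlicz.normD Φ ℱ P f)) ∧
    (∀ R : ℝ≥0, ∃ C : ℝ≥0, 0 < C ∧
      ∀ (Ω : Type u) (m0 : MeasurableSpace Ω) (P : Measure Ω) (_ : IsProbabilityMeasure P)
        (ℱ : Filtration ℕ m0), WeakOrlicz.IsRegular ℱ P R →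
        (WeakOrlicz.spaceHS Φ ℱ P = WeakOrlicz.spaceQ Φ ℱ P ∧
          WeakOrlicz.spaceQ Φ ℱ P = WeakOrlicz.spaceD Φ ℱ P ∧
          WeakOrlicz.spaceD Φ ℱ P = WeakOrlicz.spaceH Φ ℱ P ∧
          WeakOrlicz.spaceH Φ ℱ P = WeakOrlicz.spaceHs Φ ℱ P) ∧
        ∀ f : ℕ → Ω → ℝ, Martingale f ℱ P →
          ∀ a ∈ ({WeakOrlicz.normHS Φ P f, WeakOrlicz.normQ Φ ℱ P f, WeakOrlicz.normD Φ ℱ P f,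
              WeakOrlicz.normH Φ P f, WeakOrlicz.normHs Φ ℱ P f} : Set ℝ≥0∞),
          ∀ b ∈ ({WeakOrlicz.normHS Φ P f, WeakOrlicz.normQ Φ ℱ P f, WeakOrlicz.normD Φ ℱ P f,
              WeakOrlicz.normH Φ P f, WeakOrlicz.normHs Φ ℱ P f} : Set ℝ≥0∞),
          a ≤ C * b) := by
  obtain ⟨C, hC, hCa⟩ := hΦ.exists_norm_comparison.{u} hℓ hℓ1 hconc
  refine ⟨⟨C, hC, fun Ω m0 P hP ℱ f hf => ?_⟩, fun R => ?_⟩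
  · obtain ⟨h1, h2, h3, h4, h5⟩ := hCa Ω m0 P hP ℱ f hf
    refine ⟨h1, h2, h3, ?_, h5⟩
    rwa [mul_comm, ← div_eq_mul_inv, ENNReal.div_le_iff (by simpa using hC.ne')
      ENNReal.coe_ne_top, mul_comm]
  obtain ⟨Cr, hCr, hCb⟩ := WeakOrlicz.IsRegular.exists_norm_comparison.{u} hℓ hℓ1 hΦ hconc R
  -- All quasi-norms are compared with that of `wH_Φ^s`, along the cycles
  -- `S ≤ s ≤ 𝒬 ≤ S` and `M ≤ s ≤ 𝒟 ≤ M`.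
  set K : ℝ≥0 := max 1 (max C Cr) with hK
  have hK1 : (1 : ℝ≥0∞) ≤ K := by exact_mod_cast le_max_left _ _
  have hCK : (C : ℝ≥0∞) ≤ K := by exact_mod_cast (le_max_left _ _).trans (le_max_right _ _)
  have hCrK : (Cr : ℝ≥0∞) ≤ K := by exact_mod_cast (le_max_right _ _).trans (le_max_right _ _)
  have key : ∀ (Ω : Type u) (m0 : MeasurableSpace Ω) (P : Measure Ω) (_ : IsProbabilityMeasure P)
      (ℱ : Filtration ℕ m0), WeakOrlicz.IsRegular ℱ P R → ∀ f : ℕ → Ω → ℝ, Martingale f ℱ P →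
      ∀ a ∈ ({WeakOrlicz.normHS Φ P f, WeakOrlicz.normQ Φ ℱ P f, WeakOrlicz.normD Φ ℱ P f,
          WeakOrlicz.normH Φ P f, WeakOrlicz.normHs Φ ℱ P f} : Set ℝ≥0∞),
      a ≤ ((K * K : ℝ≥0) : ℝ≥0∞) * WeakOrlicz.normHs Φ ℱ P f ∧
        WeakOrlicz.normHs Φ ℱ P f ≤ ((K * K : ℝ≥0) : ℝ≥0∞) * a := by
    intro Ω m0 P hP ℱ hreg f hf a ha
    obtain ⟨⟨hMs, hSs⟩, ⟨-, -, hsQ⟩, ⟨-, -, hsD⟩, -, -⟩ := hCa Ω m0 P hP ℱ f hf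
    obtain ⟨hQS, hDM⟩ := hCb Ω m0 P hP ℱ hreg f hf.1
    have up : ∀ {x y : ℝ≥0∞} {A : ℝ≥0}, (A : ℝ≥0∞) ≤ K → x ≤ A * y → x ≤ K * y :=
      fun hA h => h.trans (mul_le_mul_left hA _)
    have one : ∀ {x y : ℝ≥0∞}, x ≤ K * y → x ≤ ((K * K : ℝ≥0) : ℝ≥0∞) * y := fun {x y} h => by
      rw [ENNReal.coe_mul, mul_assoc]
      exact h.trans (mul_le_mul_right (le_mul_of_one_le_left' hK1) _)
    have two : ∀ {x y z : ℝ≥0∞}, x ≤ K * y → y ≤ K * z → x ≤ ((K * K : ℝ≥0) : ℝ≥0∞) * z :=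
      fun {x y z} h h' => by
      rw [ENNReal.coe_mul, mul_assoc]
      exact h.trans (mul_le_mul_right h' _)
    replace hMs := up hCK hMs
    replace hSs := up hCK hSs
    replace hsQ := up hCK hsQ
    replace hsD := up hCK hsD
    replace hQS := up hCrK hQS
    replace hDM := up hCrK hDM
    simp only [mem_insert_iff, mem_singleton_iff] at ha
    rcases ha with rfl | rfl | rfl | rfl | rfl
    · exact ⟨one hSs, two hsQ hQS⟩
    · exact ⟨two hQS hSs, one hsQ⟩
    · exact ⟨two hDM hMs, one hsD⟩
    · exact ⟨one hMs, two hsD hDM⟩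
    · exact ⟨one (le_mul_of_one_le_left' hK1), one (le_mul_of_one_le_left' hK1)⟩
  have hK0 : 0 < K := lt_of_lt_of_le one_pos (le_max_left _ _)
  refine ⟨K * K * (K * K), by positivity, fun Ω m0 P hP ℱ hreg => ?_⟩
  have all : ∀ f : ℕ → Ω → ℝ, Martingale f ℱ P →
      ∀ a ∈ ({WeakOrlicz.normHS Φ P f, WeakOrlicz.normQ Φ ℱ P f, WeakOrlicz.normD Φ ℱ P f,
          WeakOrlicz.normH Φ P f, WeakOrlicz.normHs Φ ℱ P f} : Set ℝ≥0∞),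
      ∀ b ∈ ({WeakOrlicz.normHS Φ P f, WeakOrlicz.normQ Φ ℱ P f, WeakOrlicz.normD Φ ℱ P f,
          WeakOrlicz.normH Φ P f, WeakOrlicz.normHs Φ ℱ P f} : Set ℝ≥0∞),
      a ≤ ((K * K * (K * K) : ℝ≥0) : ℝ≥0∞) * b := by
    intro f hf a ha b hb
    rw [ENNReal.coe_mul, mul_assoc]
    exact ((key Ω m0 P hP ℱ hreg f hf a ha).1).trans
      (mul_le_mul_right (key Ω m0 P hP ℱ hreg f hf b hb).2 _)
  have fin : ∀ f : ℕ → Ω → ℝ, Martingale f ℱ P →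
      ∀ a ∈ ({WeakOrlicz.normHS Φ P f, WeakOrlicz.normQ Φ ℱ P f, WeakOrlicz.normD Φ ℱ P f,
          WeakOrlicz.normH Φ P f, WeakOrlicz.normHs Φ ℱ P f} : Set ℝ≥0∞),
      ∀ b ∈ ({WeakOrlicz.normHS Φ P f, WeakOrlicz.normQ Φ ℱ P f, WeakOrlicz.normD Φ ℱ P f,
          WeakOrlicz.normH Φ P f, WeakOrlicz.normHs Φ ℱ P f} : Set ℝ≥0∞),
      a < ∞ ↔ b < ∞ := fun f hf a ha b hb =>
    ⟨fun h => (all f hf b hb a ha).trans_lt (ENNReal.mul_lt_top ENNReal.coe_lt_top h),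
      fun h => (all f hf a ha b hb).trans_lt (ENNReal.mul_lt_top ENNReal.coe_lt_top h)⟩
  refine ⟨⟨Set.ext fun f => ?_, Set.ext fun f => ?_, Set.ext fun f => ?_, Set.ext fun f => ?_⟩, all⟩
  · rw [WeakOrlicz.mem_spaceQ_iff]
    exact and_congr_right fun hf => fin f hf _ (by simp) _ (by simp)
  · rw [WeakOrlicz.mem_spaceQ_iff, WeakOrlicz.mem_spaceD_iff]
    exact and_congr_right fun hf => fin f hf _ (by simp) _ (by simp)
  · rw [WeakOrlicz.mem_spaceD_iff]
    exact and_congr_right fun hf => fin f hf _ (by simp) _ (by simp)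
  · exact and_congr_right fun hf => fin f hf _ (by simp) _ (by simp)
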